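/- Let $\mathbb{K}$ be $\mathbb{R}$ or $\mathbb{C}$, let $p$ be a computable real number with $p \ge 1$ and $p \ne 2$, let $\ell^p$ be the Banach space of $p$-summable sequences $(a_n)_{n\in\mathbb{N}}$ in $\mathbb{K}$, and let $E = (e_n)_{n \in \mathbb{N}}$ be its standard unit vectors. Let $C \subseteq \mathbb{N}$ be computably enumerable. Then there is an effective generating set $F = (f_n)_{n \in \mathbb{N}}$ of $\ell^p$ such that, with respect to $(E,F)$, the oracle $C$ computes a surjective linear isometry of $\ell^p$, and such that every oracle $X \subseteq \mathbb{N}$ which, with respect to $(E,F)$, computes some surjective linear isometry of $\ell^p$ also computes $C$ (i.e. $C \le_T X$). Here a rational point is an element of $\mathbb{Q}$ if $\mathbb{K}=\mathbb{R}$ and of $\mathbb{Q}+i\mathbb{Q}$ if $\mathbb{K}=\mathbb{C}$. The sequence $F$ is an effective generating set if its linear span is dense in $\ell^p$ and there is an algorithm that, given rational points $\alpha_0,\dots,\alpha_M$ and $k \in \mathbb{N}$, produces $q \in \mathbb{Q}$ with $q - 2^{-k} < \bigl\|\sum_{j=0}^M \alpha_j f_j\bigr\| < q + 2^{-k}$.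 A ball rational with respect to $F$ is an open ball $B\bigl(\sum_{j=0}^M \alpha_j f_j; r\bigr)$ with rational points $\alpha_j$ and rational $r>0$ (and likewise for $E$). An oracle $X$ computes $T : \ell^p \to \ell^p$ with respect to $(E,F)$ if there is an algorithm $P$ with oracle $X$ that, given (a code of) a ball $B$ rational with respect to $E$, either does not halt or produces (a code of) a ball $B'$ rational with respect to $F$, such that $T(B) \subseteq B'$ whenever $P$ produces $B'$ on input $B$, and such that for every $v \in \ell^p$ and every neighborhood $U$ of $T(v)$ there is a ball $B$ rational with respect to $E$ with $v \in B$ on which $P$ halts and produces a ball included in $U$. -/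

import Mathlib

open scoped ENNReal

/-! ### Oracles -/

namespace EffBanach

open Classical in
/-- The characteristic function of a set of natural numbers, as an oracle. -/
noncomputable def charFun (X : Set ℕ) : ℕ →. ℕ :=
  fun n => Part.some (if n ∈ X then 1 else 0)

/-- The oracle `X` computes the set `C`, i.e. `C` is Turing reducible to `X`. -/
def Computes (X C : Set ℕ) : Prop :=
  TuringReducible (charFun C) (charFun X)

/-- `C` is computably enumerable: it is the domain of a partial recursive function. -/
def IsCE (C : Set ℕ) : Prop :=
  REPred fun n : ℕ => n ∈ C

/-! ### Codes of rational numbers, rational points and finite sequences of them -/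

/-- Codes of rational numbers: `(a, b, c)` is a code of `(a - b) / (c + 1)`. -/
abbrev RatCode : Type := ℕ × ℕ × ℕ

/-- The rational number (as a real number) with a given code. -/
noncomputable def RatCode.val (q : RatCode) : ℝ :=
  ((q.1 : ℝ) - (q.2.1 : ℝ)) / ((q.2.2 : ℝ) + 1)

/-- Codes of positive rational numbers: `(a, b)` is a code of `(a + 1) / (b + 1)`. -/
abbrev PosRatCode : Type := ℕ × ℕ

/-- The positive rational number (as a real number) with a given code. -/
noncomputable def PosRatCode.val (r : PosRatCode) : ℝ :=
  ((r.1 : ℝ) + 1) / ((r.2 : ℝ) + 1)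

/-- Codes of rational points of the scalar field: a pair of codes of rational numbers. -/
abbrev PointCode : Type := RatCode × RatCode

section Scalars

variable (𝕜 : Type*) [RCLike 𝕜]

/-- The rational point of `𝕜` with a given code: `x + i y` with `x`, `y` rational if `𝕜 = ℂ`.
If `𝕜 = ℝ`, then `RCLike.I = 0` and it is the rational number `x`. -/
noncomputable def PointCode.val (z : PointCode) : 𝕜 :=
  (RatCode.val z.1 : 𝕜) + (RatCode.val z.2 : 𝕜) * RCLike.I

/-- A real number is computable if some algorithm produces, given `k`, a rational number at
distance less than `2 ^ (-k)`. -/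
def IsComputableReal (x : ℝ) : Prop :=
  ∃ q : ℕ → RatCode, Computable q ∧ ∀ k, |RatCode.val (q k) - x| < (2 : ℝ)⁻¹ ^ k

variable {V W : Type*} [NormedAddCommGroup V] [NormedSpace 𝕜 V]
  [NormedAddCommGroup W] [NormedSpace 𝕜 W]

/-- The rational linear combination `∑ j, α j • f j` of the vectors of the sequence `f`, where
`α` is the finite sequence of rational points coded by `l`. -/
noncomputable def ratComb (f : ℕ → V) (l : List PointCode) : V :=
  ∑ j : Fin l.length, PointCode.val 𝕜 (l.get j) • f j

/-! ### Effective generating sets -/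

/-- `f 0, f 1, …` is a generating set of `V`: its linear span is dense. -/
def IsGenerating (f : ℕ → V) : Prop :=
  closure (Submodule.span 𝕜 (Set.range f) : Set V) = Set.univ

/-- `f 0, f 1, …` is an effective generating set of `V`: it is a generating set, and some
algorithm, given rational points `α 0, …, α M` and `k`, produces a rational number `q` with
`q - 2 ^ (-k) < ‖∑ j, α j • f j‖ < q + 2 ^ (-k)`. -/
def IsEffectiveGenerating (f : ℕ → V) : Prop :=
  IsGenerating 𝕜 f ∧
    ∃ N : List PointCode × ℕ → RatCode, Computable N ∧
      ∀ (l : List PointCode) (k : ℕ),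
        RatCode.val (N (l, k)) - (2 : ℝ)⁻¹ ^ k < ‖ratComb 𝕜 f l‖ ∧
          ‖ratComb 𝕜 f l‖ < RatCode.val (N (l, k)) + (2 : ℝ)⁻¹ ^ k

/-! ### Rational balls and computable maps -/

/-- Codes of rational balls: the coefficients of the centre, and the radius. -/
abbrev BallCode : Type := List PointCode × PosRatCode

/-- The open ball, rational with respect to `f`, with a given code. -/
noncomputable def ratBall (f : ℕ → V) (b : BallCode) : Set V :=
  Metric.ball (ratComb 𝕜 f b.1) (PosRatCode.val b.2)

/-- The oracle `X` computes the map `T : V → W` with respect to `(f, g)`: some algorithm `P` with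
oracle `X`, which on (the code of) a ball rational with respect to `f` either does not halt or
produces (the code of) a ball rational with respect to `g`, satisfies the correctness and the
convergence criteria. -/
def OracleComputesMap (X : Set ℕ) (f : ℕ → V) (g : ℕ → W) (T : V → W) : Prop :=
  ∃ P : BallCode →. BallCode, RecursiveIn {charFun X} P ∧
    (∀ b b' : BallCode, b' ∈ P b → ∀ v ∈ ratBall 𝕜 f b, T v ∈ ratBall 𝕜 g b') ∧
    (∀ v : V, ∀ U ∈ nhds (T v), ∃ b b' : BallCode,
      v ∈ ratBall 𝕜 f b ∧ b' ∈ P b ∧ ratBall 𝕜 g b' ⊆ U)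

/-- With respect to `(f, g)`, the oracle `X` computes a linear isometry of `V` onto `W`. -/
def OracleComputesIsometry (X : Set ℕ) (f : ℕ → V) (g : ℕ → W) : Prop :=
  ∃ T : V ≃ₗᵢ[𝕜] W, OracleComputesMap 𝕜 X f g T

/-! ### The sequence space and its standard generating set -/

/-- The space `ℓ^p` of sequences with entries in `𝕜`. -/
abbrev SeqSpace (p : ℝ≥0∞) : Type _ := lp (fun _ : ℕ => 𝕜) p

/-- The standard generating set `e 0, e 1, …` of `ℓ^p`. -/
noncomputable def stdGen (p : ℝ≥0∞) (n : ℕ) : SeqSpace 𝕜 p := lp.single p n (1 : 𝕜)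

end Scalars

end EffBanach

/-! The set `C` is hidden in one vector. Enumerate `C` without repetition, put `v n = 2^{-(m+2)}` if
`m` appears at stage `n` and `v n = 0` otherwise, and let `γ = ∑ (v n)^p ≤ 1/2`. Let `d = (1 -
γ)^{1/p}` and `w = d e_0 + ∑ v n e_{n+1}`, a unit vector, and let `F` be `w, e_1, e_2, …`. The
number `γ` is computable from below, but approximating it from above amounts to deciding `C`.

`F` is effective although `d` need not be computable: beyond finitely many coordinates a rational
combination is a multiple of `w`, and `‖w‖ = 1` turns the contribution of `d` and of the tail into
one minus a finite sum (`norm_rpow_sub`, `compIn_norm_perturbed`). The oracle `C` computes `γ`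
(`compIn_weightSum`), hence `d`, hence all distances between rational combinations of `E` and of
`F`, and this suffices to compute the identity map (`oracleComputesMap_id`).

Conversely, for `p ≠ 2` disjointness of supports is expressible through norms, so every surjective
isometry `T` preserves it, and `T e_j = c e_0` for some `j` and some unimodular `c`
(`exists_map_stdGen_eq`). Only `w` has a nonzero coordinate of index `0` among the vectors of `F`,
so a small `F`-ball around `c e_0` whose centre has first coefficient `α` gives `|α| d ≈ 1`, hence
lower bounds of `d` (`lowerIn_of_oracleComputesIsometry`). These are upper bounds of `γ = 1 - d^p`,
from which `C` is decided (`computes_of_lowerIn_neg_weightSum`).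

Real numbers are handled through their rational cuts: `REIn` is relative enumerability, `LowerIn`
enumerability of the rational lower bounds, and `CompIn` that of both cuts. Algorithms are extracted
at the end by unbounded search (`REIn.exists_computableIn`). -/

/-! ### Computability relative to oracles. -/

section Oracle

open Encodable Part

variable {α β γ σ : Type*} [Primcodable α] [Primcodable β] [Primcodable γ] [Primcodable σ]
variable {O : Set (ℕ →. ℕ)}

theorem RecursiveIn.comp {f : β →. σ} {g : α → β} (hf : RecursiveIn O f)
    (hg : ComputableIn O g) : RecursiveIn O fun a => f (g a) := by
  refine Nat.RecursiveIn.of_eq (Nat.RecursiveIn.comp hf hg) fun n => ?_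
  simp only [map_some, bind_eq_bind]
  rcases e : decode (α := α) n with - | a <;> simp [encodek]

theorem ComputableIn.comp {f : β → σ} {g : α → β} (hf : ComputableIn O f)
    (hg : ComputableIn O g) : ComputableIn O fun a => f (g a) :=
  RecursiveIn.comp (f := fun b => Part.some (f b)) hf hg

theorem ComputableIn.pair {f : α → β} {g : α → γ} (hf : ComputableIn O f)
    (hg : ComputableIn O g) : ComputableIn O fun a => (f a, g a) := by
  refine Nat.RecursiveIn.of_eq (Nat.RecursiveIn.pair hf hg) fun n => ?_
  rcases decode (α := α) n <;> simp [Seq.seq]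

theorem ComputableIn.nat_rec {f : α → ℕ} {g : α → σ} {h : α × ℕ × σ → σ}
    (hf : ComputableIn O f) (hg : ComputableIn O g) (hh : ComputableIn O h) :
    ComputableIn O fun a =>
      Nat.rec (motive := fun _ => σ) (g a) (fun y IH => h (a, y, IH)) (f a) := by
  have hs : Nat.RecursiveIn O (Part.some : ℕ →. ℕ) := Nat.Partrec.some.recursiveIn
  refine Nat.RecursiveIn.of_eq
    ((Nat.RecursiveIn.prec hg hh).comp (hs.pair hf)) fun n => ?_
  rcases e : decode (α := α) n with - | a
  · simp [Seq.seq]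
  · simp only [Seq.seq]
    simp
    induction f a <;> simp_all

theorem RecursiveIn.rfind {p : α × ℕ → Bool} (hp : ComputableIn O p) :
    RecursiveIn O fun a => Nat.rfind fun n => Part.some (p (a, n)) := by
  -- Unbounded search on `ℕ` looks for a zero, so `true` becomes `0`.
  have h : ComputableIn O fun q : α × ℕ => cond (p q) 0 1 :=
    ComputableIn.comp (Primrec.dom_bool fun b => cond b 0 1).computableIn hp
  refine Nat.RecursiveIn.of_eq (Nat.RecursiveIn.rfind h) fun n => ?_
  rcases e : decode (α := α) n with - | a
  · simpa [e] using Nat.rfind_zero_none _ rfl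
  · simp [e, map_id']
    congr 1
    funext m
    cases p (a, m) <;> rfl

theorem ComputableIn.and {f g : α → Bool} (hf : ComputableIn O f) (hg : ComputableIn O g) :
    ComputableIn O fun a => f a && g a :=
  ComputableIn.comp (f := fun p : Bool × Bool => p.1 && p.2)
    (Primrec.dom_finite _).computableIn (hf.pair hg)

theorem ComputableIn.or {f g : α → Bool} (hf : ComputableIn O f) (hg : ComputableIn O g) :
    ComputableIn O fun a => f a || g a :=
  ComputableIn.comp (f := fun p : Bool × Bool => p.1 || p.2)
    (Primrec.dom_finite _).computableIn (hf.pair hg)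

theorem ComputableIn.decide {p : α → Prop} [DecidablePred p] (hp : PrimrecPred p) :
    ComputableIn O fun a => decide (p a) :=
  hp.decide.computableIn

namespace EffBanach

/-- The Boolean `∀ m < n, f m`, defined by recursion. -/
def allBelow (f : ℕ → Bool) (n : ℕ) : Bool :=
  Nat.rec (motive := fun _ => Bool) true (fun y IH => IH && f y) n

/-- The Boolean `∃ m < n, f m`, defined by recursion. -/
def anyBelow (f : ℕ → Bool) (n : ℕ) : Bool :=
  Nat.rec (motive := fun _ => Bool) false (fun y IH => IH || f y) n

theorem allBelow_iff {f : ℕ → Bool} {n : ℕ} : allBelow f n = true ↔ ∀ m < n, f m = true := by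
  induction n with
  | zero => simp [allBelow]
  | succ n ih =>
    have : allBelow f (n + 1) = (allBelow f n && f n) := rfl
    rw [this, Bool.and_eq_true, ih, Nat.forall_lt_succ_right]

theorem anyBelow_iff {f : ℕ → Bool} {n : ℕ} : anyBelow f n = true ↔ ∃ m < n, f m = true := by
  induction n with
  | zero => simp [anyBelow]
  | succ n ih =>
    have : anyBelow f (n + 1) = (anyBelow f n || f n) := rfl
    rw [this, Bool.or_eq_true, ih, Nat.exists_lt_succ_right]

theorem _root_.ComputableIn.allBelow {f : α × ℕ → Bool} {g : α → ℕ} (hf : ComputableIn O f)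
    (hg : ComputableIn O g) : ComputableIn O fun a => allBelow (fun m => f (a, m)) (g a) :=
  ComputableIn.nat_rec (h := fun q : α × ℕ × Bool => q.2.2 && f (q.1, q.2.1)) hg
    (ComputableIn.const true)
    (ComputableIn.and (Primrec.snd.comp Primrec.snd).computableIn
      (hf.comp (Primrec.pair Primrec.fst (Primrec.fst.comp Primrec.snd)).computableIn))

theorem _root_.ComputableIn.anyBelow {f : α × ℕ → Bool} {g : α → ℕ} (hf : ComputableIn O f)
    (hg : ComputableIn O g) : ComputableIn O fun a => anyBelow (fun m => f (a, m)) (g a) :=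
  ComputableIn.nat_rec (h := fun q : α × ℕ × Bool => q.2.2 || f (q.1, q.2.1)) hg
    (ComputableIn.const false)
    (ComputableIn.or (Primrec.snd.comp Primrec.snd).computableIn
      (hf.comp (Primrec.pair Primrec.fst (Primrec.fst.comp Primrec.snd)).computableIn))

/-! ### Enumerable predicates relative to oracles. -/

/-- The predicate `P` is computably enumerable relative to the oracles `O`: it is the projection
of a predicate decidable relative to `O`. -/
def REIn (O : Set (ℕ →. ℕ)) (P : α → Prop) : Prop :=
  ∃ f : α × ℕ → Bool, ComputableIn O f ∧ ∀ a, P a ↔ ∃ n, f (a, n) = true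

namespace REIn

variable {P Q : α → Prop}

theorem of_iff (hP : REIn O P) (H : ∀ a, Q a ↔ P a) : REIn O Q := by
  obtain ⟨f, hf, h⟩ := hP
  exact ⟨f, hf, fun a => (H a).trans (h a)⟩

theorem of_computableIn {f : α → Bool} (hf : ComputableIn O f) :
    REIn O fun a => f a = true :=
  ⟨fun q => f q.1, hf.comp ComputableIn.fst, fun a => by simp⟩

theorem of_primrecPred (hP : PrimrecPred P) : REIn O P := by
  classical
  exact (of_computableIn (ComputableIn.decide hP)).of_iff fun a => by simp

theorem comp {P : β → Prop} {g : α → β} (hP : REIn O P) (hg : ComputableIn O g) :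
    REIn O fun a => P (g a) := by
  obtain ⟨f, hf, h⟩ := hP
  exact ⟨fun q => f (g q.1, q.2),
    hf.comp ((hg.comp ComputableIn.fst).pair ComputableIn.snd), fun a => h (g a)⟩

theorem and (hP : REIn O P) (hQ : REIn O Q) : REIn O fun a => P a ∧ Q a := by
  obtain ⟨f, hf, h⟩ := hP
  obtain ⟨g, hg, h'⟩ := hQ
  refine ⟨fun q => f (q.1, q.2.unpair.1) && g (q.1, q.2.unpair.2), ?_, fun a => ?_⟩
  · have hu : ComputableIn O fun q : α × ℕ => q.2.unpair :=
      (Primrec.unpair.comp Primrec.snd).computableIn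
    exact ComputableIn.and
      (hf.comp (ComputableIn.fst.pair (ComputableIn.fst.comp hu)))
      (hg.comp (ComputableIn.fst.pair (ComputableIn.snd.comp hu)))
  · refine (and_congr (h a) (h' a)).trans ?_
    constructor
    · rintro ⟨⟨m, hm⟩, n, hn⟩
      exact ⟨Nat.pair m n, by simp [hm, hn]⟩
    · rintro ⟨n, hn⟩
      rw [Bool.and_eq_true] at hn
      exact ⟨⟨_, hn.1⟩, _, hn.2⟩

theorem or (hP : REIn O P) (hQ : REIn O Q) : REIn O fun a => P a ∨ Q a := by
  obtain ⟨f, hf, h⟩ := hP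
  obtain ⟨g, hg, h'⟩ := hQ
  refine ⟨fun q => f q || g q, hf.or hg, fun a => ?_⟩
  simp only [h, h', Bool.or_eq_true, exists_or]

/-- One natural number codes both `b` and the witness for `P a b`. Numbers that decode to no element
of `β` are read as `b₀`, which is harmless. -/
theorem ex {P : α → β → Prop} (hP : REIn O fun q : α × β => P q.1 q.2) :
    REIn O fun a => ∃ b, P a b := by
  obtain ⟨f, hf, h⟩ := hP
  have hd : Computable fun q : α × ℕ => (decode (α := β) q.2.unpair.1) :=
    (Primrec.decode.comp (Primrec.fst.comp (Primrec.unpair.comp Primrec.snd))).to_comp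
  obtain hβ | ⟨⟨b₀⟩⟩ := isEmpty_or_nonempty β
  · exact ⟨fun _ => false, ComputableIn.const _, fun a => by simp⟩
  have hdec : ComputableIn O fun q : α × ℕ => (decode (α := β) q.2.unpair.1).getD b₀ :=
    (Computable.option_getD hd (Computable.const b₀)).computableIn
  refine ⟨fun q => f ((q.1, (decode (α := β) q.2.unpair.1).getD b₀), q.2.unpair.2),
    hf.comp ((ComputableIn.fst.pair hdec).pair
      (Primrec.snd.comp (Primrec.unpair.comp Primrec.snd)).computableIn), fun a => ?_⟩
  constructor
  · rintro ⟨b, hb⟩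
    obtain ⟨n, hn⟩ := (h (a, b)).1 hb
    exact ⟨Nat.pair (encode b) n, by simpa using hn⟩
  · rintro ⟨n, hn⟩
    exact ⟨_, (h (a, _)).2 ⟨_, hn⟩⟩

/-- Finitely many witnesses have a common bound, so the existential quantifier can be moved in front
of the bounded universal one. -/
theorem forall_lt {P : α → ℕ → Prop} {g : α → ℕ} (hP : REIn O fun q : α × ℕ => P q.1 q.2)
    (hg : ComputableIn O g) : REIn O fun a => ∀ m < g a, P a m := by
  obtain ⟨f, hf, h⟩ := hP
  refine ⟨fun q => EffBanach.allBelow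
    (fun m => EffBanach.anyBelow (fun k => f ((q.1, m), k)) q.2) (g q.1), ?_, fun a => ?_⟩
  · refine ComputableIn.allBelow (f := fun r : (α × ℕ) × ℕ =>
      EffBanach.anyBelow (fun k => f ((r.1.1, r.2), k)) r.1.2) ?_ (hg.comp ComputableIn.fst)
    refine ComputableIn.anyBelow (f := fun s : ((α × ℕ) × ℕ) × ℕ =>
      f ((s.1.1.1, s.1.2), s.2)) (hf.comp ?_)
      (Primrec.snd.comp Primrec.fst).computableIn
    exact (Primrec.pair (Primrec.pair
      (Primrec.fst.comp (Primrec.fst.comp Primrec.fst)) (Primrec.snd.comp Primrec.fst))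
      Primrec.snd).computableIn
  · simp only [allBelow_iff, anyBelow_iff]
    constructor
    · intro H
      have : ∀ m, ∃ k, m < g a → f ((a, m), k) = true := fun m => by
        by_cases hm : m < g a
        · obtain ⟨k, hk⟩ := (h (a, m)).1 (H m hm)
          exact ⟨k, fun _ => hk⟩
        · exact ⟨0, fun h => absurd h hm⟩
      choose k hk using this
      refine ⟨(Finset.range (g a)).sup k + 1, fun m hm => ⟨k m, ?_, hk m hm⟩⟩
      exact Nat.lt_succ_of_le (Finset.le_sup (f := k) (Finset.mem_range.2 hm))
    · rintro ⟨n, hn⟩ m hm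
      obtain ⟨k, -, hk⟩ := hn m hm
      exact (h (a, m)).2 ⟨k, hk⟩

end REIn

/-- A total relation computably enumerable relative to `O` has a choice function computable
relative to `O`. -/
theorem REIn.exists_computableIn {R : α → β → Prop} (hR : REIn O fun q : α × β => R q.1 q.2)
    (htot : ∀ a, ∃ b, R a b) : ∃ g : α → β, ComputableIn O g ∧ ∀ a, R a (g a) := by
  obtain ⟨f, hf, h⟩ := hR
  obtain hα | ⟨⟨a₀⟩⟩ := isEmpty_or_nonempty α
  · exact ⟨fun a => hα.elim a,
      Nat.RecursiveIn.of_eq (Nat.Partrec.none.recursiveIn) fun n => by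
        rcases decode (α := α) n with - | a
        · simp
        · exact hα.elim a, fun a => hα.elim a⟩
  obtain ⟨b₀, -⟩ := htot a₀
  have hd : Computable fun n : ℕ => (decode (α := β) n.unpair.1).getD b₀ :=
    Computable.option_getD
      (Primrec.decode.comp (Primrec.fst.comp Primrec.unpair)).to_comp (Computable.const b₀)
  let p : α × ℕ → Bool := fun q =>
    f ((q.1, (decode (α := β) q.2.unpair.1).getD b₀), q.2.unpair.2)
  have hp : ComputableIn O p :=
    hf.comp ((ComputableIn.fst.pair (hd.computableIn.comp ComputableIn.snd)).pair
      (Primrec.snd.comp (Primrec.unpair.comp Primrec.snd)).computableIn)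
  have hex : ∀ a, ∃ n, p (a, n) = true := fun a => by
    obtain ⟨b, hb⟩ := htot a
    obtain ⟨n, hn⟩ := (h (a, b)).1 hb
    exact ⟨Nat.pair (encode b) n, by simpa [p] using hn⟩
  have hfind : ComputableIn O fun a => Nat.find (hex a) := by
    refine RecursiveIn.of_eq (RecursiveIn.rfind hp) fun a => ?_
    refine Part.eq_some_iff.2 (Nat.mem_rfind.2 ⟨?_, fun {m} hm => ?_⟩)
    · simpa using (Nat.find_spec (hex a)).symm
    · simpa using (Bool.eq_false_iff.2 (Nat.find_min (hex a) hm)).symm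
  exact ⟨_, hd.computableIn.comp hfind, fun a => (h (a, _)).2 ⟨_, Nat.find_spec (hex a)⟩⟩

/-- The graph of a function recursive relative to total oracles is computably enumerable
relative to these oracles. -/
theorem REIn.graph_nat (hO : ∀ g ∈ O, ∃ t : ℕ → ℕ, g = fun n => Part.some (t n)) {f : ℕ →. ℕ}
    (hf : Nat.RecursiveIn O f) : REIn O fun q : ℕ × ℕ => q.2 ∈ f q.1 := by
  have total : ∀ {t : ℕ → ℕ}, ComputableIn O t → REIn O fun q : ℕ × ℕ => q.2 = t q.1 :=
    fun {t} ht => (REIn.of_computableIn (f := fun q : ℕ × ℕ => decide (q.2 = t q.1))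
      (ComputableIn.comp (f := fun q : ℕ × ℕ => decide (q.1 = q.2))
        (ComputableIn.decide (p := fun q : ℕ × ℕ => q.1 = q.2) Primrec.eq)
        (ComputableIn.snd.pair (ht.comp ComputableIn.fst)))).of_iff fun q => by simp
  induction hf with
  | zero =>
    exact (total (ComputableIn.const 0)).of_iff fun q => by
      simp [show (0 : Part ℕ) = Part.some 0 from rfl]
  | succ =>
    exact (total ComputableIn.succ).of_iff fun q => by simp
  | left =>
    exact (total (ComputableIn.fst.comp ComputableIn.unpair)).of_iff fun q => by simp
  | right =>
    exact (total (ComputableIn.snd.comp ComputableIn.unpair)).of_iff fun q => by simp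
  | oracle g hg =>
    obtain ⟨t, rfl⟩ := hO g hg
    exact (total (RecursiveIn.iff_nat.2 (.oracle _ hg))).of_iff fun q => by simp
  | @pair f h hf hh ihf ihh =>
    have h1 : REIn O fun q : (ℕ × ℕ) × ℕ × ℕ => q.2.1 ∈ f q.1.1 := ihf.comp
      (Primrec.pair (Primrec.fst.comp Primrec.fst) (Primrec.fst.comp Primrec.snd)).computableIn
    have h2 : REIn O fun q : (ℕ × ℕ) × ℕ × ℕ => q.2.2 ∈ h q.1.1 := ihh.comp
      (Primrec.pair (Primrec.fst.comp Primrec.fst) (Primrec.snd.comp Primrec.snd)).computableIn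
    have h3 : REIn O fun q : (ℕ × ℕ) × ℕ × ℕ => q.1.2 = Nat.pair q.2.1 q.2.2 :=
      REIn.of_primrecPred (Primrec.eq.comp (Primrec.snd.comp Primrec.fst)
        (Primrec₂.natPair.comp (Primrec.fst.comp Primrec.snd) (Primrec.snd.comp Primrec.snd)))
    refine (REIn.ex (P := fun (a : ℕ × ℕ) (b : ℕ × ℕ) =>
      b.1 ∈ f a.1 ∧ b.2 ∈ h a.1 ∧ a.2 = Nat.pair b.1 b.2) (h1.and (h2.and h3))).of_iff ?_
    rintro ⟨a, b⟩
    simp [Seq.seq, eq_comm]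
  | @comp f h hf hh ihf ihh =>
    have h1 : REIn O fun q : (ℕ × ℕ) × ℕ => q.2 ∈ h q.1.1 := ihh.comp
      (Primrec.pair (Primrec.fst.comp Primrec.fst) Primrec.snd).computableIn
    have h2 : REIn O fun q : (ℕ × ℕ) × ℕ => q.1.2 ∈ f q.2 := ihf.comp
      (Primrec.pair Primrec.snd (Primrec.snd.comp Primrec.fst)).computableIn
    refine (REIn.ex (P := fun (a : ℕ × ℕ) (b : ℕ) => b ∈ h a.1 ∧ a.2 ∈ f b)
      (h1.and h2)).of_iff ?_
    rintro ⟨a, b⟩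
    exact Part.mem_bind_iff
  | @prec f h hf hh ihf ihh =>
    -- A value of a primitive recursion is witnessed by the list of all intermediate values, whose
    -- entry `y` is the value after `y` steps.
    have hn : Primrec fun q : (ℕ × ℕ) × List ℕ => q.1.1.unpair.2 :=
      Primrec.snd.comp (Primrec.unpair.comp (Primrec.fst.comp Primrec.fst))
    have h1 : REIn O fun q : (ℕ × ℕ) × List ℕ => q.2.getD 0 0 ∈ f q.1.1.unpair.1 := ihf.comp
      (Primrec.pair (Primrec.fst.comp (Primrec.unpair.comp (Primrec.fst.comp Primrec.fst)))
        ((Primrec.list_getD 0).comp Primrec.snd (Primrec.const 0))).computableIn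
    have h2 : REIn O fun q : (ℕ × ℕ) × List ℕ => q.2.getD q.1.1.unpair.2 0 = q.1.2 :=
      REIn.of_primrecPred (Primrec.eq.comp
        ((Primrec.list_getD 0).comp Primrec.snd hn) (Primrec.snd.comp Primrec.fst))
    have hy : Primrec fun q : ((ℕ × ℕ) × List ℕ) × ℕ => q.1.2.getD q.2 0 :=
      (Primrec.list_getD 0).comp (Primrec.snd.comp Primrec.fst) Primrec.snd
    have hy' : Primrec fun q : ((ℕ × ℕ) × List ℕ) × ℕ => q.1.2.getD (q.2 + 1) 0 :=
      (Primrec.list_getD 0).comp (Primrec.snd.comp Primrec.fst) (Primrec.succ.comp Primrec.snd)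
    have ha : Primrec fun q : ((ℕ × ℕ) × List ℕ) × ℕ => q.1.1.1.unpair.1 :=
      Primrec.fst.comp (Primrec.unpair.comp
        (Primrec.fst.comp (Primrec.fst.comp Primrec.fst)))
    have h3 : REIn O fun q : (ℕ × ℕ) × List ℕ => ∀ y < q.1.1.unpair.2,
        q.2.getD (y + 1) 0 ∈ h (Nat.pair q.1.1.unpair.1 (Nat.pair y (q.2.getD y 0))) :=
      REIn.forall_lt (P := fun (q : (ℕ × ℕ) × List ℕ) (y : ℕ) =>
        q.2.getD (y + 1) 0 ∈ h (Nat.pair q.1.1.unpair.1 (Nat.pair y (q.2.getD y 0))))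
        (ihh.comp (Primrec.pair (Primrec₂.natPair.comp ha
          (Primrec₂.natPair.comp Primrec.snd hy)) hy').computableIn) hn.computableIn
    refine (REIn.ex (P := fun (q : ℕ × ℕ) (l : List ℕ) => l.getD 0 0 ∈ f q.1.unpair.1 ∧
      l.getD q.1.unpair.2 0 = q.2 ∧ ∀ y < q.1.unpair.2,
        l.getD (y + 1) 0 ∈ h (Nat.pair q.1.unpair.1 (Nat.pair y (l.getD y 0))))
      (h1.and (h2.and h3))).of_iff ?_
    rintro ⟨x, b⟩
    simp only
    generalize x.unpair.1 = a
    generalize x.unpair.2 = n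
    constructor
    · intro H
      suffices ∃ l : List ℕ, l.length = n + 1 ∧ l.getD 0 0 ∈ f a ∧ l.getD n 0 = b ∧ ∀ y < n,
          l.getD (y + 1) 0 ∈ h (Nat.pair a (Nat.pair y (l.getD y 0))) by
        obtain ⟨l, -, hl⟩ := this
        exact ⟨l, hl⟩
      induction n generalizing b with
      | zero =>
    exact ⟨[b], by simpa using H⟩
      | succ n ih =>
        obtain ⟨c, hc, hb⟩ := Part.mem_bind_iff.1 H
        obtain ⟨l, hlen, h0, hl, hstep⟩ := ih _ hc
        have hlt : ∀ y ≤ n, (l ++ [b]).getD y 0 = l.getD y 0 := fun y hy =>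
          List.getD_append _ _ _ _ (by omega)
        have hlast : (l ++ [b]).getD (n + 1) 0 = b := by
          rw [List.getD_append_right _ _ _ _ (by omega), hlen]; simp
        refine ⟨l ++ [b], by simp [hlen], by rwa [hlt _ (Nat.zero_le _)], hlast,
          fun y hy => ?_⟩
        rcases Nat.lt_succ_iff_lt_or_eq.1 hy with hy | rfl
        · rw [hlt _ hy, hlt _ hy.le]
          exact hstep y hy
        · rw [hlast, hlt _ le_rfl, hl]
          exact hb
    · rintro ⟨l, h0, rfl, hstep⟩
      induction n with
      | zero =>
    exact h0
      | succ n ih =>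
        exact Part.mem_bind_iff.2 ⟨_, ih fun y hy => hstep y (hy.trans n.lt_succ_self),
          hstep n n.lt_succ_self⟩
  | @rfind f hf ihf =>
    have h1 : REIn O fun q : ℕ × ℕ => 0 ∈ f (Nat.pair q.1 q.2) := ihf.comp
      (Primrec.pair (Primrec₂.natPair.comp Primrec.fst Primrec.snd)
        (Primrec.const 0)).computableIn
    -- All earlier values must be defined and nonzero. Asking for a value of the form `k + 1` keeps
    -- the condition enumerable.
    have h2 : REIn O fun q : ((ℕ × ℕ) × ℕ) × ℕ =>
        q.2 + 1 ∈ f (Nat.pair q.1.1.1 q.1.2) := ihf.comp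
      (Primrec.pair (Primrec₂.natPair.comp (Primrec.fst.comp (Primrec.fst.comp Primrec.fst))
        (Primrec.snd.comp Primrec.fst)) (Primrec.succ.comp Primrec.snd)).computableIn
    have h3 : REIn O fun q : ℕ × ℕ =>
        ∀ m < q.2, ∃ k, k + 1 ∈ f (Nat.pair q.1 m) :=
      REIn.forall_lt (P := fun (q : ℕ × ℕ) (m : ℕ) => ∃ k, k + 1 ∈ f (Nat.pair q.1 m))
        (REIn.ex (P := fun (q : (ℕ × ℕ) × ℕ) k => k + 1 ∈ f (Nat.pair q.1.1 q.2)) h2)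
        ComputableIn.snd
    refine (h1.and h3).of_iff ?_
    rintro ⟨a, n⟩
    refine Nat.mem_rfind.trans (and_congr ?_ (forall₂_congr fun m hm => ?_))
    · simp
    · refine (Part.mem_map_iff _).trans ?_
      constructor
      · rintro ⟨k, hk, h0⟩
        exact ⟨k - 1, by rwa [Nat.sub_add_cancel (Nat.pos_of_ne_zero (by simpa using h0))]⟩
      · rintro ⟨k, hk⟩
        exact ⟨k + 1, hk, by simp⟩

theorem REIn.graph (hO : ∀ g ∈ O, ∃ t : ℕ → ℕ, g = fun n => Part.some (t n)) {f : α →. σ}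
    (hf : RecursiveIn O f) : REIn O fun q : α × σ => q.2 ∈ f q.1 := by
  refine ((REIn.graph_nat hO hf).comp (g := fun q : α × σ => (encode q.1, encode q.2))
    (Primrec.pair (Primrec.encode.comp Primrec.fst)
      (Primrec.encode.comp Primrec.snd)).computableIn).of_iff ?_
  rintro ⟨a, b⟩
  simp [encodek]

theorem REIn.mono {O' : Set (ℕ →. ℕ)} {P : α → Prop} (hP : REIn O P) (hO : O ⊆ O') :
    REIn O' P := by
  obtain ⟨f, hf, h⟩ := hP
  exact ⟨f, RecursiveIn.mono hO hf, h⟩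

theorem REIn.of_rePred {P : α → Prop} (hP : REPred P) : REIn O P := by
  have h : REIn (∅ : Set (ℕ →. ℕ)) fun q : α × Unit =>
      q.2 ∈ Part.assert (P q.1) fun _ => Part.some () :=
    REIn.graph (by simp) (Partrec.recursiveIn hP)
  refine ((h.mono (Set.empty_subset O)).comp (g := fun a : α => (a, ()))
    (Primrec.pair Primrec.id (Primrec.const ())).computableIn).of_iff fun a => ?_
  simp

theorem _root_.Computable.of_computableIn_empty {f : α → σ} (hf : ComputableIn ∅ f) : Computable f :=
  recursiveIn_empty_iff.1 hf

end EffBanach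

end Oracle

/-! ### Arithmetic of natural numbers and of codes of rationals. -/

section PrimrecArith

variable {α : Type*} [Primcodable α]

theorem Primrec.nat_add_comp {f g : α → ℕ} (hf : Primrec f) (hg : Primrec g) :
    Primrec fun a => f a + g a :=
  Primrec.nat_add.comp hf hg

theorem Primrec.nat_sub_comp {f g : α → ℕ} (hf : Primrec f) (hg : Primrec g) :
    Primrec fun a => f a - g a :=
  Primrec.nat_sub.comp hf hg

theorem Primrec.nat_mul_comp {f g : α → ℕ} (hf : Primrec f) (hg : Primrec g) :
    Primrec fun a => f a * g a :=
  Primrec.nat_mul.comp hf hg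

theorem Primrec.nat_pow_comp {f g : α → ℕ} (hf : Primrec f) (hg : Primrec g) :
    Primrec fun a => f a ^ g a :=
  Primrec₂.comp (Primrec₂.unpaired'.1 Nat.Primrec.pow) hf hg

end PrimrecArith

namespace EffBanach

open Primrec

section RatCode

variable {α : Type*} [Primcodable α]

namespace RatCode

theorem den_pos (q : RatCode) : (0 : ℝ) < (q.2.2 : ℝ) + 1 := by positivity

/-- A code of the opposite of a rational number. -/
def neg (q : RatCode) : RatCode := (q.2.1, q.1, q.2.2)

/-- A code of the sum of two rational numbers. -/
def add (q r : RatCode) : RatCode :=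
  (q.1 * (r.2.2 + 1) + r.1 * (q.2.2 + 1), q.2.1 * (r.2.2 + 1) + r.2.1 * (q.2.2 + 1),
    q.2.2 * r.2.2 + q.2.2 + r.2.2)

/-- A code of the product of two rational numbers. -/
def mul (q r : RatCode) : RatCode :=
  (q.1 * r.1 + q.2.1 * r.2.1, q.1 * r.2.1 + q.2.1 * r.1, q.2.2 * r.2.2 + q.2.2 + r.2.2)

@[simp] theorem val_neg (q : RatCode) : (neg q).val = -q.val := by
  simp only [val, neg]
  ring

@[simp] theorem val_add (q r : RatCode) : (add q r).val = q.val + r.val := by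
  have hq := q.den_pos
  have hr := r.den_pos
  -- A code stores its denominator minus one, whence this third component.
  have : ((q.2.2 * r.2.2 + q.2.2 + r.2.2 : ℕ) : ℝ) + 1 = (q.2.2 + 1) * (r.2.2 + 1) := by
    push_cast; ring
  simp only [val, add, this]
  field_simp
  push_cast
  ring

@[simp] theorem val_mul (q r : RatCode) : (mul q r).val = q.val * r.val := by
  have hq := q.den_pos
  have hr := r.den_pos
  have : ((q.2.2 * r.2.2 + q.2.2 + r.2.2 : ℕ) : ℝ) + 1 = (q.2.2 + 1) * (r.2.2 + 1) := by
    push_cast; ring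
  simp only [val, mul, this]
  field_simp
  push_cast
  ring

@[simp] theorem val_zero : val (0, 0, 0) = 0 := by simp [val]

@[simp] theorem val_one : val (1, 0, 0) = 1 := by simp [val]

theorem primrec_neg : Primrec neg :=
  (fst.comp snd).pair (fst.pair (snd.comp snd))

theorem primrec_add : Primrec₂ add := by
  have a : Primrec fun q : RatCode × RatCode => q.1.1 := fst.comp fst
  have b : Primrec fun q : RatCode × RatCode => q.1.2.1 := fst.comp (snd.comp fst)
  have c : Primrec fun q : RatCode × RatCode => q.1.2.2 := snd.comp (snd.comp fst)
  have a' : Primrec fun q : RatCode × RatCode => q.2.1 := fst.comp snd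
  have b' : Primrec fun q : RatCode × RatCode => q.2.2.1 := fst.comp (snd.comp snd)
  have c' : Primrec fun q : RatCode × RatCode => q.2.2.2 := snd.comp (snd.comp snd)
  have hc := succ.comp c
  have hc' := succ.comp c'
  exact ((nat_mul_comp a hc').nat_add_comp (nat_mul_comp a' hc)).pair
    (((nat_mul_comp b hc').nat_add_comp (nat_mul_comp b' hc)).pair
      (((nat_mul_comp c c').nat_add_comp c).nat_add_comp c'))

theorem primrec_mul : Primrec₂ mul := by
  have a : Primrec fun q : RatCode × RatCode => q.1.1 := fst.comp fst
  have b : Primrec fun q : RatCode × RatCode => q.1.2.1 := fst.comp (snd.comp fst)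
  have c : Primrec fun q : RatCode × RatCode => q.1.2.2 := snd.comp (snd.comp fst)
  have a' : Primrec fun q : RatCode × RatCode => q.2.1 := fst.comp snd
  have b' : Primrec fun q : RatCode × RatCode => q.2.2.1 := fst.comp (snd.comp snd)
  have c' : Primrec fun q : RatCode × RatCode => q.2.2.2 := snd.comp (snd.comp snd)
  exact ((nat_mul_comp a a').nat_add_comp (nat_mul_comp b b')).pair
    (((nat_mul_comp a b').nat_add_comp (nat_mul_comp b a')).pair
      (((nat_mul_comp c c').nat_add_comp c).nat_add_comp c'))

/-- Cross-multiplying and moving the negative parts across leaves an inequality between natural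
numbers, hence a primitive recursive test. -/
theorem val_lt_val {q r : RatCode} : q.val < r.val ↔
    q.1 * (r.2.2 + 1) + r.2.1 * (q.2.2 + 1) < r.1 * (q.2.2 + 1) + q.2.1 * (r.2.2 + 1) := by
  rw [val, val, div_lt_div_iff₀ q.den_pos r.den_pos, ← Nat.cast_lt (α := ℝ)]
  push_cast
  constructor <;> intro h <;> linarith

theorem primrec_lt : PrimrecRel fun q r : RatCode => q.val < r.val := by
  have a : Primrec fun q : RatCode × RatCode => q.1.1 := fst.comp fst
  have b : Primrec fun q : RatCode × RatCode => q.1.2.1 := fst.comp (snd.comp fst)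
  have c : Primrec fun q : RatCode × RatCode => q.1.2.2 + 1 :=
    succ.comp (snd.comp (snd.comp fst))
  have a' : Primrec fun q : RatCode × RatCode => q.2.1 := fst.comp snd
  have b' : Primrec fun q : RatCode × RatCode => q.2.2.1 := fst.comp (snd.comp snd)
  have c' : Primrec fun q : RatCode × RatCode => q.2.2.2 + 1 :=
    succ.comp (snd.comp (snd.comp snd))
  exact PrimrecPred.of_eq (nat_lt.comp
    ((nat_mul_comp a c').nat_add_comp (nat_mul_comp b' c))
    ((nat_mul_comp a' c).nat_add_comp (nat_mul_comp b c'))) fun q => val_lt_val.symm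

theorem exists_val_eq (q : ℚ) : ∃ r : RatCode, r.val = q := by
  refine ⟨(q.num.toNat, (-q.num).toNat, q.den - 1), ?_⟩
  have hd : ((q.den - 1 : ℕ) : ℝ) + 1 = q.den := by
    rw [Nat.cast_sub q.den_pos]; simp
  have hn : ((q.num.toNat : ℕ) : ℝ) - ((-q.num).toNat : ℕ) = (q.num : ℝ) := by
    have : ((q.num.toNat : ℕ) : ℤ) - ((-q.num).toNat : ℕ) = q.num := by omega
    exact_mod_cast congrArg (Int.cast (R := ℝ)) this
  simp only [val, hd, hn]
  exact (Rat.cast_def q).symm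

theorem exists_btwn {x y : ℝ} (h : x < y) : ∃ r : RatCode, x < r.val ∧ r.val < y := by
  obtain ⟨q, hx, hy⟩ := exists_rat_btwn h
  obtain ⟨r, hr⟩ := exists_val_eq q
  exact ⟨r, hr ▸ hx, hr ▸ hy⟩

/-- A code of the sum of a finite sequence of rational numbers. -/
def sum (l : List RatCode) : RatCode := l.foldr add (0, 0, 0)

theorem val_sum (l : List RatCode) :
    (sum l).val = ∑ n ∈ Finset.range l.length, (l.getD n (0, 0, 0)).val := by
  induction l with
  | nil => simp [sum]
  | cons a l ih =>
    have : sum (a :: l) = add a (sum l) := rfl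
    rw [this, val_add, ih, List.length_cons, Finset.sum_range_succ']
    simp [add_comm]

theorem primrec_sum : Primrec sum :=
  list_foldr (h := fun _ q => add q.1 q.2) Primrec.id (Primrec.const (0, 0, 0))
    (primrec_add.comp (fst.comp snd) (snd.comp snd))

/-- The absolute value of the numerator. -/
def absNum (q : RatCode) : ℕ := (q.1 - q.2.1) + (q.2.1 - q.1)

theorem abs_val (q : RatCode) : |q.val| = (absNum q : ℝ) / (q.2.2 + 1) := by
  rw [val, abs_div, abs_of_pos q.den_pos, absNum]
  congr 1
  rcases le_total q.1 q.2.1 with h | h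
  · have h' : (q.1 : ℝ) ≤ q.2.1 := by exact_mod_cast h
    rw [Nat.sub_eq_zero_of_le h, abs_of_nonpos (by linarith), zero_add, Nat.cast_sub h]
    ring
  · have h' : (q.2.1 : ℝ) ≤ q.1 := by exact_mod_cast h
    rw [Nat.sub_eq_zero_of_le h, abs_of_nonneg (by linarith), add_zero, Nat.cast_sub h]

/-- Truncated subtraction takes the positive part of the numerator. -/
theorem max_val_zero (q : RatCode) : max q.val 0 = ((q.1 - q.2.1 : ℕ) : ℝ) / (q.2.2 + 1) := by
  rcases le_total q.1 q.2.1 with h | h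
  · have h' : (q.1 : ℝ) ≤ q.2.1 := by exact_mod_cast h
    rw [Nat.sub_eq_zero_of_le h, max_eq_right]
    · simp
    · exact div_nonpos_of_nonpos_of_nonneg (by linarith) q.den_pos.le
  · have h' : (q.2.1 : ℝ) ≤ q.1 := by exact_mod_cast h
    rw [Nat.cast_sub h, max_eq_left, val]
    exact div_nonneg (by linarith) q.den_pos.le

theorem primrec_absNum : Primrec absNum :=
  (nat_sub_comp fst (fst.comp snd)).nat_add_comp (nat_sub_comp (fst.comp snd) fst)

end RatCode

end RatCode

/-! ### Semicomputable and computable real numbers. -/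

section CompIn

variable {α β : Type*} [Primcodable α] [Primcodable β] {O : Set (ℕ →. ℕ)}

/-- The real numbers `x a` are lower semicomputable relative to `O`, uniformly in `a`. -/
def LowerIn (O : Set (ℕ →. ℕ)) (x : α → ℝ) : Prop :=
  REIn O fun q : α × RatCode => q.2.val < x q.1

/-- The real numbers `x a` are computable relative to `O`, uniformly in `a`. -/
structure CompIn (O : Set (ℕ →. ℕ)) (x : α → ℝ) : Prop where
  lower : LowerIn O x
  upper : LowerIn O fun a => -x a

variable {x y : α → ℝ}

namespace LowerIn

theorem of_eq (hx : LowerIn O x) (h : ∀ a, x a = y a) : LowerIn O y :=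
  (funext h : x = y) ▸ hx

theorem comp {x : β → ℝ} {g : α → β} (hx : LowerIn O x) (hg : ComputableIn O g) :
    LowerIn O fun a => x (g a) :=
  REIn.comp (g := fun q : α × RatCode => (g q.1, q.2)) hx
    ((hg.comp ComputableIn.fst).pair ComputableIn.snd)

theorem lt_right (hx : LowerIn O x) {g : α → RatCode} (hg : ComputableIn O g) :
    REIn O fun a => (g a).val < x a :=
  REIn.comp (g := fun a => (a, g a)) hx (ComputableIn.id.pair hg)

theorem gt_right (hx : LowerIn O fun a => -x a) {g : α → RatCode} (hg : ComputableIn O g) :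
    REIn O fun a => x a < (g a).val :=
  (lt_right hx (RatCode.primrec_neg.computableIn.comp hg)).of_iff fun a => by simp

theorem upper_iff : (LowerIn O fun a => -x a) ↔ REIn O fun q : α × RatCode => x q.1 < q.2.val :=
  ⟨fun h => gt_right (x := fun q : α × RatCode => x q.1)
      (h.comp (g := Prod.fst) ComputableIn.fst) ComputableIn.snd,
    fun h => (h.comp (g := fun q : α × RatCode => (q.1, RatCode.neg q.2))
      (ComputableIn.fst.pair (RatCode.primrec_neg.computableIn.comp ComputableIn.snd))).of_iff
      fun q => by simp [lt_neg]⟩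

theorem rat {g : α → RatCode} (hg : ComputableIn O g) : LowerIn O fun a => (g a).val :=
  (REIn.of_primrecPred RatCode.primrec_lt).comp (g := fun q : α × RatCode => (q.2, g q.1))
    (ComputableIn.snd.pair (hg.comp ComputableIn.fst))

/-- A strict inequality is witnessed by a rational number in between. -/
theorem lt (hx : LowerIn O fun a => -x a) (hy : LowerIn O y) : REIn O fun a => x a < y a := by
  refine (REIn.ex (P := fun a (r : RatCode) => x a < r.val ∧ r.val < y a)
    ((upper_iff.1 hx).and hy)).of_iff fun a => ?_
  exact ⟨RatCode.exists_btwn, fun ⟨r, h⟩ => h.1.trans h.2⟩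

theorem add (hx : LowerIn O x) (hy : LowerIn O y) : LowerIn O fun a => x a + y a := by
  have h1 : REIn O fun q : (α × RatCode) × RatCode => q.2.val < x q.1.1 :=
    lt_right (x := fun q : (α × RatCode) × RatCode => x q.1.1)
      (hx.comp (fst.comp fst).computableIn) ComputableIn.snd
  have h2 : REIn O fun q : (α × RatCode) × RatCode =>
      (RatCode.add q.1.2 (RatCode.neg q.2)).val < y q.1.1 :=
    lt_right (x := fun q : (α × RatCode) × RatCode => y q.1.1)
      (hy.comp (fst.comp fst).computableIn)
      (RatCode.primrec_add.comp (snd.comp fst) (RatCode.primrec_neg.comp snd)).computableIn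
  refine (REIn.ex (P := fun (q : α × RatCode) (r : RatCode) => r.val < x q.1 ∧
    (RatCode.add q.2 (RatCode.neg r)).val < y q.1) (h1.and h2)).of_iff fun q => ?_
  simp only [RatCode.val_add, RatCode.val_neg]
  constructor
  · intro h
    obtain ⟨r, hr, hr'⟩ := RatCode.exists_btwn (show q.2.val - y q.1 < x q.1 by linarith)
    exact ⟨r, hr', by linarith⟩
  · rintro ⟨r, h, h'⟩
    linarith

/-- The witness is a list of rational lower bounds, one for each term. -/
theorem sum_range {x : α × ℕ → ℝ} {g : α → ℕ} (hx : LowerIn O x) (hg : ComputableIn O g) :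
    LowerIn O fun a => ∑ n ∈ Finset.range (g a), x (a, n) := by
  have h1 : REIn O fun q : (α × RatCode) × List RatCode => q.2.length = g q.1.1 := by
    refine (REIn.of_primrecPred (P := fun q : ℕ × ℕ => q.1 = q.2) Primrec.eq).comp
      (g := fun q : (α × RatCode) × List RatCode => (q.2.length, g q.1.1)) ?_
    exact ComputableIn.pair (list_length.comp snd).computableIn
      (hg.comp (fst.comp fst).computableIn)
  have h2 : REIn O fun q : (α × RatCode) × List RatCode =>
      ∀ n < g q.1.1, (q.2.getD n (0, 0, 0)).val < x (q.1.1, n) := by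
    refine REIn.forall_lt (P := fun (q : (α × RatCode) × List RatCode) n =>
      (q.2.getD n (0, 0, 0)).val < x (q.1.1, n)) ?_ (hg.comp (fst.comp fst).computableIn)
    exact lt_right (x := fun q : ((α × RatCode) × List RatCode) × ℕ => x (q.1.1.1, q.2))
      (hx.comp (pair (fst.comp (fst.comp fst)) snd).computableIn)
      ((list_getD (0, 0, 0)).comp (snd.comp fst) snd).computableIn
  have h3 : REIn O fun q : (α × RatCode) × List RatCode => q.1.2.val < (RatCode.sum q.2).val :=
    REIn.of_primrecPred (RatCode.primrec_lt.comp (snd.comp fst) (RatCode.primrec_sum.comp snd))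
  refine (REIn.ex (P := fun (q : α × RatCode) (l : List RatCode) => l.length = g q.1 ∧
    (∀ n < g q.1, (l.getD n (0, 0, 0)).val < x (q.1, n)) ∧ q.2.val < (RatCode.sum l).val)
    (h1.and (h2.and h3))).of_iff ?_
  rintro ⟨a, q⟩
  simp only
  constructor
  · intro h
    -- The gap is cut into one share more than there are terms, so that something remains after each
    -- term has lost one share, even for the empty sum.
    set ε : ℝ := (∑ n ∈ Finset.range (g a), x (a, n) - q.val) / (g a + 1) with hε
    have hg0 : (0 : ℝ) < g a + 1 := by positivity
    have hε0 : 0 < ε := div_pos (by linarith) hg0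
    choose r hr hr' using fun n =>
      RatCode.exists_btwn (show x (a, n) - ε < x (a, n) by linarith)
    have hget : ∀ n < g a, ((List.range (g a)).map r).getD n (0, 0, 0) = r n := fun n hn => by
      simp [List.getD, hn]
    refine ⟨(List.range (g a)).map r, by simp, fun n hn => by rw [hget n hn]; exact hr' n, ?_⟩
    rw [RatCode.val_sum, List.length_map, List.length_range]
    have h1 : ∑ n ∈ Finset.range (g a), (x (a, n) - ε) ≤
        ∑ n ∈ Finset.range (g a), (((List.range (g a)).map r).getD n (0, 0, 0)).val :=
      Finset.sum_le_sum fun n hn => by rw [hget n (Finset.mem_range.1 hn)]; exact (hr n).le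
    rw [Finset.sum_sub_distrib, Finset.sum_const, Finset.card_range, nsmul_eq_mul] at h1
    have h2 : ε * (g a + 1) = ∑ n ∈ Finset.range (g a), x (a, n) - q.val :=
      div_mul_cancel₀ _ hg0.ne'
    linarith
  · rintro ⟨l, hl, h, hq⟩
    refine hq.trans_le ?_
    rw [RatCode.val_sum, hl]
    exact Finset.sum_le_sum fun n hn => (h n (Finset.mem_range.1 hn)).le

theorem sup (hx : LowerIn O x) (hy : LowerIn O y) : LowerIn O fun a => max (x a) (y a) :=
  (REIn.or hx hy).of_iff fun _ => lt_max_iff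

theorem inf (hx : LowerIn O x) (hy : LowerIn O y) : LowerIn O fun a => min (x a) (y a) :=
  (REIn.and hx hy).of_iff fun _ => lt_min_iff

/-- By monotonicity and continuity, `Φ (x a)` is approached from below by `Φ |r|` with `r` rational
and `|r| < x a`. No such `r` exists if `x a = 0`, so `Φ 0` is compared separately. -/
theorem map {Φ : ℝ → ℝ} (hmono : MonotoneOn Φ (Set.Ici 0)) (hcont : Continuous Φ)
    (hΦ : LowerIn O fun r : RatCode => Φ |r.val|) (hx : LowerIn O x) (hx0 : ∀ a, 0 ≤ x a) :
    LowerIn O fun a => Φ (x a) := by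
  have h0 : LowerIn O fun _ : α => Φ 0 :=
    (hΦ.comp (ComputableIn.const (0, 0, 0))).of_eq fun a => by simp
  have h1 : REIn O fun q : (α × RatCode) × RatCode => q.2.val < x q.1.1 :=
    lt_right (x := fun q : (α × RatCode) × RatCode => x q.1.1)
      (hx.comp (fst.comp fst).computableIn) ComputableIn.snd
  have h2 : REIn O fun q : (α × RatCode) × RatCode => -q.2.val < x q.1.1 :=
    (lt_right (x := fun q : (α × RatCode) × RatCode => x q.1.1)
      (hx.comp (fst.comp fst).computableIn)
      (RatCode.primrec_neg.comp snd).computableIn).of_iff fun q => by simp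
  have h3 : REIn O fun q : (α × RatCode) × RatCode => q.1.2.val < Φ |q.2.val| :=
    lt_right (x := fun q : (α × RatCode) × RatCode => Φ |q.2.val|)
      (hΦ.comp ComputableIn.snd) (snd.comp fst).computableIn
  refine (REIn.or h0 (REIn.ex (P := fun (q : α × RatCode) (r : RatCode) => r.val < x q.1 ∧
    -r.val < x q.1 ∧ q.2.val < Φ |r.val|) (h1.and (h2.and h3)))).of_iff ?_
  rintro ⟨a, q⟩
  simp only
  constructor
  · intro h
    rcases (hx0 a).eq_or_lt with h0 | h0
    · exact Or.inl (h0 ▸ h)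
    · obtain ⟨ε, hε, H⟩ := Metric.mem_nhds_iff.1
        ((isOpen_lt continuous_const hcont).mem_nhds (show x a ∈ {t | q.val < Φ t} from h))
      obtain ⟨r, hr, hr'⟩ := RatCode.exists_btwn (show max 0 (x a - ε) < x a by
        rw [max_lt_iff]; constructor <;> linarith)
      rw [max_lt_iff] at hr
      refine Or.inr ⟨r, hr', by linarith, ?_⟩
      rw [abs_of_pos hr.1]
      refine H ?_
      rw [Metric.mem_ball, Real.dist_eq, abs_lt]
      constructor <;> linarith
  · rintro (h | ⟨r, h, h', hq⟩)
    · exact h.trans_le (hmono (Set.self_mem_Ici) (hx0 a) (hx0 a))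
    · exact hq.trans_le (hmono (Set.mem_Ici.2 (abs_nonneg _)) (hx0 a) (abs_le.2 ⟨by linarith, h.le⟩))

/-- Rationals above `x a` always exist, so zero needs no separate treatment here. -/
theorem neg_map {Φ : ℝ → ℝ} (hmono : MonotoneOn Φ (Set.Ici 0)) (hcont : Continuous Φ)
    (hΦ : LowerIn O fun r : RatCode => -Φ |r.val|) (hx : LowerIn O fun a => -x a)
    (hx0 : ∀ a, 0 ≤ x a) : LowerIn O fun a => -Φ (x a) := by
  have h1 : REIn O fun q : (α × RatCode) × RatCode => x q.1.1 < q.2.val :=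
    gt_right (x := fun q : (α × RatCode) × RatCode => x q.1.1)
      (hx.comp (fst.comp fst).computableIn) ComputableIn.snd
  have h3 : REIn O fun q : (α × RatCode) × RatCode => Φ |q.2.val| < q.1.2.val :=
    gt_right (x := fun q : (α × RatCode) × RatCode => Φ |q.2.val|)
      (hΦ.comp (g := Prod.snd) ComputableIn.snd) (snd.comp fst).computableIn
  refine upper_iff.2 ((REIn.ex (P := fun (q : α × RatCode) (r : RatCode) => x q.1 < r.val ∧
    Φ |r.val| < q.2.val) (h1.and h3)).of_iff ?_)
  rintro ⟨a, q⟩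
  simp only
  constructor
  · intro h
    obtain ⟨ε, hε, H⟩ := Metric.mem_nhds_iff.1
      ((isOpen_lt hcont continuous_const).mem_nhds (show x a ∈ {t | Φ t < q.val} from h))
    obtain ⟨r, hr, hr'⟩ := RatCode.exists_btwn (show x a < x a + ε by linarith)
    refine ⟨r, hr, ?_⟩
    rw [abs_of_pos ((hx0 a).trans_lt hr)]
    refine H ?_
    rw [Metric.mem_ball, Real.dist_eq, abs_lt]
    constructor <;> linarith
  · rintro ⟨r, h, hq⟩
    exact (hmono (hx0 a) (Set.mem_Ici.2 (abs_nonneg _)) (h.le.trans (le_abs_self _))).trans_lt hq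

end LowerIn

namespace CompIn

theorem of_eq (hx : CompIn O x) (h : ∀ a, x a = y a) : CompIn O y :=
  (funext h : x = y) ▸ hx

theorem comp {x : β → ℝ} {g : α → β} (hx : CompIn O x) (hg : ComputableIn O g) :
    CompIn O fun a => x (g a) :=
  ⟨hx.lower.comp hg, hx.upper.comp (x := fun b => -x b) hg⟩

theorem rat {g : α → RatCode} (hg : ComputableIn O g) : CompIn O fun a => (g a).val :=
  ⟨LowerIn.rat hg, (LowerIn.rat (RatCode.primrec_neg.computableIn.comp hg)).of_eq fun a => by
    simp⟩

theorem neg (hx : CompIn O x) : CompIn O fun a => -x a :=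
  ⟨hx.upper, hx.lower.of_eq fun _ => (neg_neg _).symm⟩

theorem add (hx : CompIn O x) (hy : CompIn O y) : CompIn O fun a => x a + y a :=
  ⟨hx.lower.add hy.lower, (hx.upper.add hy.upper).of_eq fun a => by ring⟩

theorem sub (hx : CompIn O x) (hy : CompIn O y) : CompIn O fun a => x a - y a :=
  (hx.add hy.neg).of_eq fun a => by ring

theorem lt (hx : CompIn O x) (hy : CompIn O y) : REIn O fun a => x a < y a :=
  LowerIn.lt hx.upper hy.lower

theorem abs (hx : CompIn O x) : CompIn O fun a => |x a| :=
  ⟨hx.lower.sup hx.upper, (hx.upper.inf hx.lower).of_eq fun a => by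
    rw [abs_eq_max_neg, ← min_neg_neg, neg_neg]⟩

theorem sum_range {x : α × ℕ → ℝ} {g : α → ℕ} (hx : CompIn O x) (hg : ComputableIn O g) :
    CompIn O fun a => ∑ n ∈ Finset.range (g a), x (a, n) :=
  ⟨hx.lower.sum_range hg, (LowerIn.sum_range hx.upper hg).of_eq fun a => by simp⟩

theorem map {Φ : ℝ → ℝ} (hmono : MonotoneOn Φ (Set.Ici 0)) (hcont : Continuous Φ)
    (hΦ : CompIn O fun r : RatCode => Φ |r.val|) (hx : CompIn O x) (hx0 : ∀ a, 0 ≤ x a) :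
    CompIn O fun a => Φ (x a) :=
  ⟨LowerIn.map hmono hcont hΦ.lower hx.lower hx0, LowerIn.neg_map hmono hcont hΦ.upper hx.upper hx0⟩

/-- By polarization, `x y = |x + y|² / 4 - |x - y|² / 4`, and `t² / 4` is monotone on the
nonnegative reals. -/
theorem mul (hx : CompIn O x) (hy : CompIn O y) : CompIn O fun a => x a * y a := by
  have hΦ : CompIn O fun r : RatCode => |r.val| ^ 2 / 4 := by
    refine (rat (g := fun r : RatCode => RatCode.mul (RatCode.mul r r) (1, 0, 3))
      (RatCode.primrec_mul.comp (RatCode.primrec_mul.comp Primrec.id Primrec.id)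
        (Primrec.const _)).computableIn).of_eq fun r => ?_
    rw [RatCode.val_mul, RatCode.val_mul, sq_abs]
    norm_num [RatCode.val]
    ring
  have key : ∀ {z : α → ℝ}, CompIn O z → CompIn O fun a => |z a| ^ 2 / 4 := fun hz =>
    map (Φ := fun t => t ^ 2 / 4)
      (fun s hs t ht hst => by have := pow_le_pow_left₀ hs hst 2; simp only; linarith)
      (by fun_prop) hΦ hz.abs fun a => abs_nonneg _
  exact ((key (hx.add hy)).sub (key (hx.sub hy))).of_eq fun a => by
    rw [sq_abs, sq_abs]; ring

end CompIn

end CompIn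

/-! ### Real powers with a computable exponent. -/

section Pow

/-- The exponent is approximated by rationals from the side on which the power does not exceed `b ^
s`: from below if `1 ≤ b`, from above if `b ≤ 1`. -/
theorem lt_rpow_iff_exists {b s y : ℝ} (hb : 0 < b) (hs : 0 < s) : y < b ^ s ↔ ∃ m k : ℕ,
    ((1 ≤ b ∧ (m : ℝ) / (k + 1) < s) ∨ (b ≤ 1 ∧ s < (m : ℝ) / (k + 1))) ∧
      y < b ^ ((m : ℝ) / (k + 1)) := by
  constructor
  · intro h
    have hopen : IsOpen {t : ℝ | y < b ^ t} :=
      isOpen_lt continuous_const (Real.continuous_const_rpow hb.ne')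
    obtain ⟨ε, hε, H⟩ := Metric.mem_nhds_iff.1 (hopen.mem_nhds h)
    have hfrac : ∀ {u v : ℝ}, 0 ≤ u → u < v →
        ∃ m k : ℕ, u < (m : ℝ) / (k + 1) ∧ (m : ℝ) / (k + 1) < v := fun {u v} hu huv => by
      obtain ⟨q, hq, hq'⟩ := exists_rat_btwn huv
      have hq0 : (0 : ℚ) < q := by exact_mod_cast hu.trans_lt hq
      refine ⟨q.num.toNat, q.den - 1, ?_⟩
      have e : ((q.num.toNat : ℕ) : ℝ) / ((q.den - 1 : ℕ) + 1) = q := by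
        have h1 : ((q.num.toNat : ℕ) : ℝ) = (q.num : ℝ) := by
          exact_mod_cast congrArg (Int.cast (R := ℝ))
            (Int.toNat_of_nonneg (Rat.num_nonneg.2 hq0.le))
        have h2 : ((q.den - 1 : ℕ) : ℝ) + 1 = q.den := by
          rw [Nat.cast_sub q.den_pos]; simp
        rw [h1, h2]
        exact (Rat.cast_def q).symm
      rw [e]
      exact ⟨hq, hq'⟩
    rcases le_total 1 b with h1 | h1
    · obtain ⟨m, k, hl, hr⟩ := hfrac (le_max_left 0 (s - ε))
        (show max 0 (s - ε) < s by rw [max_lt_iff]; constructor <;> linarith)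
      refine ⟨m, k, Or.inl ⟨h1, hr⟩, H ?_⟩
      rw [max_lt_iff] at hl
      rw [Metric.mem_ball, Real.dist_eq, abs_lt]
      constructor <;> linarith
    · obtain ⟨m, k, hl, hr⟩ := hfrac hs.le (show s < s + ε by linarith)
      refine ⟨m, k, Or.inr ⟨h1, hl⟩, H ?_⟩
      rw [Metric.mem_ball, Real.dist_eq, abs_lt]
      constructor <;> linarith
  · rintro ⟨m, k, ⟨h1, h⟩ | ⟨h1, h⟩, hy⟩
    · exact hy.trans_le (Real.rpow_le_rpow_of_exponent_le h1 h.le)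
    · exact hy.trans_le (Real.rpow_le_rpow_of_exponent_ge hb h1 h.le)

/-- This is `lt_rpow_iff_exists` for `b⁻¹` and `y⁻¹`. -/
theorem rpow_lt_iff_exists {b s y : ℝ} (hb : 0 < b) (hs : 0 < s) (hy : 0 < y) :
    b ^ s < y ↔ ∃ m k : ℕ,
      ((b ≤ 1 ∧ (m : ℝ) / (k + 1) < s) ∨ (1 ≤ b ∧ s < (m : ℝ) / (k + 1))) ∧
        b ^ ((m : ℝ) / (k + 1)) < y := by
  have hinv : ∀ t : ℝ, y⁻¹ < b⁻¹ ^ t ↔ b ^ t < y := fun t => by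
    rw [Real.inv_rpow hb.le, inv_lt_inv₀ hy (Real.rpow_pos_of_pos hb t)]
  rw [← hinv, lt_rpow_iff_exists (inv_pos.2 hb) hs]
  simp only [hinv, one_le_inv₀ hb, inv_le_one₀ hb]

theorem rpow_natCast_div_pow {b : ℝ} (hb : 0 ≤ b) (m k : ℕ) :
    (b ^ ((m : ℝ) / (k + 1))) ^ (k + 1) = b ^ m := by
  rw [← Real.rpow_natCast, ← Real.rpow_mul hb, ← Real.rpow_natCast]
  congr 1
  push_cast
  field_simp

theorem div_pow_lt_div_pow_iff {a b c d : ℝ} (hb : 0 < b) (hd : 0 < d) (m k : ℕ) :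
    (a / b) ^ k < (c / d) ^ m ↔ a ^ k * d ^ m < c ^ m * b ^ k := by
  rw [div_pow, div_pow, div_lt_div_iff₀ (pow_pos hb _) (pow_pos hd _)]

/-- Raising to the power `k + 1` removes the root, so that `s` is compared only with rationals and
all else is arithmetic of natural numbers. -/
theorem nat_div_lt_rpow_iff {N : ℕ} (hN : 0 < N) {s : ℝ} (hs : 0 < s) (D Q E : ℕ) :
    (Q : ℝ) / (E + 1) < ((N : ℝ) / (D + 1)) ^ s ↔ ∃ m k : ℕ,
      ((D + 1 ≤ N ∧ (m : ℝ) / (k + 1) < s) ∨ (N ≤ D + 1 ∧ s < (m : ℝ) / (k + 1))) ∧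
        Q ^ (k + 1) * (D + 1) ^ m < N ^ m * (E + 1) ^ (k + 1) := by
  have hD : (0 : ℝ) < (D : ℝ) + 1 := by positivity
  have hE : (0 : ℝ) < (E : ℝ) + 1 := by positivity
  have hb : 0 < (N : ℝ) / (D + 1) := div_pos (by exact_mod_cast hN) hD
  have hq : 0 ≤ (Q : ℝ) / (E + 1) := by positivity
  rw [lt_rpow_iff_exists hb hs]
  refine exists_congr fun m => exists_congr fun k => ?_
  rw [one_le_div hD, div_le_one hD,
    ← pow_lt_pow_iff_left₀ hq (Real.rpow_nonneg hb.le _) k.succ_ne_zero,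
    Nat.succ_eq_add_one, rpow_natCast_div_pow hb.le, div_pow_lt_div_pow_iff hE hD]
  norm_cast

theorem rpow_lt_nat_div_iff {N Q : ℕ} (hN : 0 < N) (hQ : 0 < Q) {s : ℝ} (hs : 0 < s)
    (D E : ℕ) : ((N : ℝ) / (D + 1)) ^ s < (Q : ℝ) / (E + 1) ↔ ∃ m k : ℕ,
      ((N ≤ D + 1 ∧ (m : ℝ) / (k + 1) < s) ∨ (D + 1 ≤ N ∧ s < (m : ℝ) / (k + 1))) ∧
        N ^ m * (E + 1) ^ (k + 1) < Q ^ (k + 1) * (D + 1) ^ m := by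
  have hD : (0 : ℝ) < (D : ℝ) + 1 := by positivity
  have hE : (0 : ℝ) < (E : ℝ) + 1 := by positivity
  have hb : 0 < (N : ℝ) / (D + 1) := div_pos (by exact_mod_cast hN) hD
  have hq : 0 < (Q : ℝ) / (E + 1) := div_pos (by exact_mod_cast hQ) hE
  rw [rpow_lt_iff_exists hb hs hq]
  refine exists_congr fun m => exists_congr fun k => ?_
  rw [one_le_div hD, div_le_one hD,
    ← pow_lt_pow_iff_left₀ (Real.rpow_nonneg hb.le _) hq.le k.succ_ne_zero,
    Nat.succ_eq_add_one, rpow_natCast_div_pow hb.le, div_pow_lt_div_pow_iff hD hE]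
  norm_cast

variable {α : Type*} [Primcodable α] {O : Set (ℕ →. ℕ)} {x y : α → ℝ}

theorem CompIn.rpow_rat {s : ℝ} (hs : 0 < s) (h : CompIn O fun _ : Unit => s) :
    CompIn O fun r : RatCode => |r.val| ^ s := by
  have hfrac : Primrec fun q : (RatCode × RatCode) × ℕ × ℕ => ((q.2.1, 0, q.2.2) : RatCode) :=
    pair (fst.comp snd) (pair (Primrec.const 0) (snd.comp snd))
  have hval : ∀ m k : ℕ, RatCode.val (m, 0, k) = (m : ℝ) / (k + 1) := fun m k => by
    simp [RatCode.val]
  have hlt : REIn O fun q : (RatCode × RatCode) × ℕ × ℕ => (q.2.1 : ℝ) / (q.2.2 + 1) < s :=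
    (LowerIn.lt_right (x := fun _ : (RatCode × RatCode) × ℕ × ℕ => s)
      (h.comp (ComputableIn.const ())).lower hfrac.computableIn).of_iff fun q => by rw [hval]
  have hgt : REIn O fun q : (RatCode × RatCode) × ℕ × ℕ => s < (q.2.1 : ℝ) / (q.2.2 + 1) :=
    (LowerIn.gt_right (x := fun _ : (RatCode × RatCode) × ℕ × ℕ => s)
      (h.comp (ComputableIn.const ())).upper hfrac.computableIn).of_iff fun q => by rw [hval]
  have hN : Primrec fun q : (RatCode × RatCode) × ℕ × ℕ => RatCode.absNum q.1.1 :=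
    RatCode.primrec_absNum.comp (fst.comp fst)
  have hD : Primrec fun q : (RatCode × RatCode) × ℕ × ℕ => q.1.1.2.2 + 1 :=
    succ.comp (snd.comp (snd.comp (fst.comp fst)))
  have hQ : Primrec fun q : (RatCode × RatCode) × ℕ × ℕ => q.1.2.1 - q.1.2.2.1 :=
    nat_sub_comp (fst.comp (snd.comp fst)) (fst.comp (snd.comp (snd.comp fst)))
  have hE : Primrec fun q : (RatCode × RatCode) × ℕ × ℕ => q.1.2.2.2 + 1 :=
    succ.comp (snd.comp (snd.comp (snd.comp fst)))
  have hm : Primrec fun q : (RatCode × RatCode) × ℕ × ℕ => q.2.1 := fst.comp snd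
  have hk : Primrec fun q : (RatCode × RatCode) × ℕ × ℕ => q.2.2 + 1 := succ.comp (snd.comp snd)
  have hle : REIn O fun q : (RatCode × RatCode) × ℕ × ℕ => RatCode.absNum q.1.1 ≤ q.1.1.2.2 + 1 :=
    REIn.of_primrecPred (nat_le.comp hN hD)
  have hge : REIn O fun q : (RatCode × RatCode) × ℕ × ℕ => q.1.1.2.2 + 1 ≤ RatCode.absNum q.1.1 :=
    REIn.of_primrecPred (nat_le.comp hD hN)
  have hL := ((nat_pow_comp hQ hk).nat_mul_comp (nat_pow_comp hD hm))
  have hR := ((nat_pow_comp hN hm).nat_mul_comp (nat_pow_comp hE hk))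
  have hlow := REIn.ex (P := fun (q : RatCode × RatCode) (r : ℕ × ℕ) =>
    ((q.1.2.2 + 1 ≤ RatCode.absNum q.1 ∧ (r.1 : ℝ) / (r.2 + 1) < s) ∨
      (RatCode.absNum q.1 ≤ q.1.2.2 + 1 ∧ s < (r.1 : ℝ) / (r.2 + 1))) ∧
    (q.2.1 - q.2.2.1) ^ (r.2 + 1) * (q.1.2.2 + 1) ^ r.1 <
      RatCode.absNum q.1 ^ r.1 * (q.2.2.2 + 1) ^ (r.2 + 1))
    (((hge.and hlt).or (hle.and hgt)).and (REIn.of_primrecPred (nat_lt.comp hL hR)))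
  have hupp := REIn.ex (P := fun (q : RatCode × RatCode) (r : ℕ × ℕ) =>
    ((RatCode.absNum q.1 ≤ q.1.2.2 + 1 ∧ (r.1 : ℝ) / (r.2 + 1) < s) ∨
      (q.1.2.2 + 1 ≤ RatCode.absNum q.1 ∧ s < (r.1 : ℝ) / (r.2 + 1))) ∧
    RatCode.absNum q.1 ^ r.1 * (q.2.2.2 + 1) ^ (r.2 + 1) <
      (q.2.1 - q.2.2.1) ^ (r.2 + 1) * (q.1.2.2 + 1) ^ r.1)
    (((hle.and hlt).or (hge.and hgt)).and (REIn.of_primrecPred (nat_lt.comp hR hL)))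
  -- The criteria above need a positive base. Base zero, where the power is zero, is a decidable
  -- separate case, and so is the sign of the rational bound.
  have hzero : PrimrecPred fun q : RatCode × RatCode => RatCode.absNum q.1 = 0 :=
    Primrec.eq.comp (RatCode.primrec_absNum.comp fst) (Primrec.const 0)
  have hneg : PrimrecPred fun q : RatCode × RatCode => q.2.val < RatCode.val (0, 0, 0) :=
    RatCode.primrec_lt.comp snd (Primrec.const (0, 0, 0))
  have hpos : PrimrecPred fun q : RatCode × RatCode => RatCode.val (0, 0, 0) < q.2.val :=
    RatCode.primrec_lt.comp (Primrec.const (0, 0, 0)) snd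
  constructor
  · refine ((REIn.of_primrecPred hneg).or
      ((REIn.of_primrecPred hzero.not).and hlow)).of_iff ?_
    rintro ⟨r, q⟩
    simp only [RatCode.val_zero, Prod.exists]
    rcases lt_or_ge q.val 0 with hq | hq
    · simp only [hq, true_or, iff_true]
      exact hq.trans_le (Real.rpow_nonneg (abs_nonneg _) _)
    rw [or_iff_right hq.not_gt, RatCode.abs_val]
    by_cases hN0 : RatCode.absNum r = 0
    · simp [hN0, Real.zero_rpow hs.ne', hq]
    rw [← max_eq_left hq, RatCode.max_val_zero,
      nat_div_lt_rpow_iff (Nat.pos_of_ne_zero hN0) hs]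
    simp only [hN0, not_false_eq_true, true_and]
  · refine LowerIn.upper_iff.2 (((REIn.of_primrecPred (hzero.and hpos)).or
      ((REIn.of_primrecPred (hzero.not.and hpos)).and hupp)).of_iff ?_)
    rintro ⟨r, q⟩
    simp only [RatCode.val_zero, Prod.exists]
    rcases le_or_gt q.val 0 with hq | hq
    · simp only [hq.not_gt, and_false, false_and, or_false, iff_false, not_lt]
      exact hq.trans (Real.rpow_nonneg (abs_nonneg _) _)
    rw [RatCode.abs_val]
    by_cases hN0 : RatCode.absNum r = 0
    · simp [hN0, Real.zero_rpow hs.ne', hq]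
    have hqv : q.val = ((q.1 - q.2.1 : ℕ) : ℝ) / (q.2.2 + 1) := by
      rw [← RatCode.max_val_zero, max_eq_left hq.le]
    have hQ0 : 0 < q.1 - q.2.1 := by
      rw [hqv, div_pos_iff_of_pos_right q.den_pos] at hq
      exact_mod_cast hq
    simp only [hN0, hq, not_false_eq_true, true_and, and_true, false_or]
    rw [hqv, rpow_lt_nat_div_iff (Nat.pos_of_ne_zero hN0) hQ0 hs]

theorem monotoneOn_rpow {s : ℝ} (hs : 0 < s) : MonotoneOn (fun t : ℝ => t ^ s) (Set.Ici 0) :=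
  fun _ ht _ _ h => Real.rpow_le_rpow ht h hs.le

theorem LowerIn.rpow {s : ℝ} (hs : 0 < s) (h : CompIn O fun _ : Unit => s) (hx : LowerIn O x)
    (hx0 : ∀ a, 0 ≤ x a) : LowerIn O fun a => x a ^ s :=
  LowerIn.map (monotoneOn_rpow hs) (Real.continuous_rpow_const hs.le)
    (CompIn.rpow_rat hs h).lower hx hx0

theorem CompIn.rpow {s : ℝ} (hs : 0 < s) (h : CompIn O fun _ : Unit => s) (hx : CompIn O x)
    (hx0 : ∀ a, 0 ≤ x a) : CompIn O fun a => x a ^ s :=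
  CompIn.map (monotoneOn_rpow hs) (Real.continuous_rpow_const hs.le) (CompIn.rpow_rat hs h) hx hx0

/-- Since `t ↦ t ^ s` is strictly increasing on the nonnegative reals, `x a` is compared with a
rational by comparing powers. This recovers a norm from its `p`-th power. -/
theorem CompIn.of_rpow {s : ℝ} (hs : 0 < s) (h : CompIn O fun _ : Unit => s)
    (hx : CompIn O fun a => x a ^ s) (hx0 : ∀ a, 0 ≤ x a) : CompIn O x := by
  have hq : CompIn O fun q : α × RatCode => |q.2.val| ^ s :=
    (CompIn.rpow_rat hs h).comp ComputableIn.snd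
  have hxs : CompIn O fun q : α × RatCode => x q.1 ^ s := hx.comp (g := Prod.fst) ComputableIn.fst
  have hneg : PrimrecPred fun q : α × RatCode => q.2.val < RatCode.val (0, 0, 0) :=
    RatCode.primrec_lt.comp snd (Primrec.const (0, 0, 0))
  have hpos : PrimrecPred fun q : α × RatCode => RatCode.val (0, 0, 0) < q.2.val :=
    RatCode.primrec_lt.comp (Primrec.const (0, 0, 0)) snd
  constructor
  · refine ((REIn.of_primrecPred hneg).or (hq.lt hxs)).of_iff ?_
    rintro ⟨a, q⟩
    simp only [RatCode.val_zero]
    rw [Real.rpow_lt_rpow_iff (abs_nonneg _) (hx0 a) hs]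
    constructor
    · intro h
      rcases lt_or_ge q.val 0 with hq | hq
      · exact Or.inl hq
      · exact Or.inr (by rwa [abs_of_nonneg hq])
    · rintro (h | h)
      · exact h.trans_le (hx0 a)
      · exact (le_abs_self _).trans_lt h
  · refine LowerIn.upper_iff.2 (((REIn.of_primrecPred hpos).and (hxs.lt hq)).of_iff ?_)
    rintro ⟨a, q⟩
    simp only [RatCode.val_zero]
    rw [Real.rpow_lt_rpow_iff (hx0 a) (abs_nonneg _) hs]
    constructor
    · intro h
      have h0 := (hx0 a).trans_lt h
      exact ⟨h0, by rwa [abs_of_pos h0]⟩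
    · rintro ⟨h0, h⟩
      rwa [abs_of_pos h0] at h

theorem RatCode.val_two_inv_pow (k : ℕ) : RatCode.val (1, 0, 2 ^ k - 1) = (2 : ℝ)⁻¹ ^ k := by
  simp [RatCode.val]

theorem RatCode.primrec_two_inv_pow : Primrec fun k : ℕ => ((1, 0, 2 ^ k - 1) : RatCode) :=
  pair (Primrec.const 1) (pair (Primrec.const 0)
    (nat_sub_comp (nat_pow_comp (Primrec.const 2) Primrec.id) (Primrec.const 1)))

theorem IsComputableReal.compIn {s : ℝ} (hs : IsComputableReal s) :
    CompIn O fun _ : Unit => s := by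
  obtain ⟨q, hq, h⟩ := hs
  have hk := RatCode.primrec_two_inv_pow
  have hlow : ComputableIn O fun k => RatCode.add (q k) (RatCode.neg (1, 0, 2 ^ k - 1)) :=
    (RatCode.primrec_add.to_comp.comp hq (RatCode.primrec_neg.comp hk).to_comp).computableIn
  have hupp : ComputableIn O fun k => RatCode.add (q k) (1, 0, 2 ^ k - 1) :=
    (RatCode.primrec_add.to_comp.comp hq hk.to_comp).computableIn
  have hlim : ∀ ε > 0, ∃ k : ℕ, (2 : ℝ)⁻¹ ^ k < ε := fun ε hε =>
    exists_pow_lt_of_lt_one hε (by norm_num)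
  constructor
  · refine (REIn.ex (P := fun (r : Unit × RatCode) (k : ℕ) =>
      r.2.val < (RatCode.add (q k) (RatCode.neg (1, 0, 2 ^ k - 1))).val)
      ((REIn.of_primrecPred RatCode.primrec_lt).comp
        (g := fun r : (Unit × RatCode) × ℕ =>
          (r.1.2, RatCode.add (q r.2) (RatCode.neg (1, 0, 2 ^ r.2 - 1))))
        ((snd.comp fst).computableIn.pair (hlow.comp ComputableIn.snd)))).of_iff ?_
    rintro ⟨-, r⟩
    simp only [RatCode.val_add, RatCode.val_neg, RatCode.val_two_inv_pow]
    constructor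
    · intro hr
      obtain ⟨k, hk⟩ := hlim ((s - r.val) / 2) (by linarith)
      have := abs_lt.1 (h k)
      exact ⟨k, by linarith⟩
    · rintro ⟨k, hk⟩
      have := abs_lt.1 (h k)
      linarith
  · refine LowerIn.upper_iff.2 ((REIn.ex (P := fun (r : Unit × RatCode) (k : ℕ) =>
      (RatCode.add (q k) (1, 0, 2 ^ k - 1)).val < r.2.val)
      ((REIn.of_primrecPred RatCode.primrec_lt).comp
        (g := fun r : (Unit × RatCode) × ℕ => (RatCode.add (q r.2) (1, 0, 2 ^ r.2 - 1), r.1.2))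
        ((hupp.comp ComputableIn.snd).pair (snd.comp fst).computableIn))).of_iff ?_)
    rintro ⟨-, r⟩
    simp only [RatCode.val_add, RatCode.val_two_inv_pow]
    constructor
    · intro hr
      obtain ⟨k, hk⟩ := hlim ((r.val - s) / 2) (by linarith)
      have := abs_lt.1 (h k)
      exact ⟨k, by linarith⟩
    · rintro ⟨k, hk⟩
      have := abs_lt.1 (h k)
      linarith

end Pow

/-! ### Norms of scalars, treating real and complex scalars together. -/

section ScalarNorm

variable (𝕜 : Type*) [RCLike 𝕜]

/-- The constant `κ` is `0` if `I = 0` (real scalars) and `1` otherwise. -/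
theorem exists_norm_sq_add_mul_I :
    ∃ κ : RatCode, ∀ x y : ℝ, ‖(x : 𝕜) + y * RCLike.I‖ ^ 2 = x * x + κ.val * (y * y) := by
  rcases RCLike.I_eq_zero_or_im_I_eq_one (K := 𝕜) with h | h
  · refine ⟨(0, 0, 0), fun x y => ?_⟩
    rw [h, RCLike.norm_sq_eq_def]
    simp
  · refine ⟨(1, 0, 0), fun x y => ?_⟩
    rw [RCLike.norm_sq_eq_def]
    simp [h]

variable {α : Type*} [Primcodable α] {O : Set (ℕ →. ℕ)} {x y : α → ℝ}

/-- The squared norm is polynomial in the two parts; the power `s / 2` of it is wanted. -/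
theorem CompIn.norm_rpow {s : ℝ} (hs : 0 < s) (h : CompIn O fun _ : Unit => s) (hx : CompIn O x)
    (hy : CompIn O y) : CompIn O fun a => ‖(x a : 𝕜) + y a * RCLike.I‖ ^ s := by
  obtain ⟨κ, hκ⟩ := exists_norm_sq_add_mul_I 𝕜
  have hhalf : CompIn O fun _ : Unit => s / 2 :=
    (h.mul (CompIn.rat (ComputableIn.const ((1, 0, 1) : RatCode)))).of_eq fun _ => by
      norm_num [RatCode.val]; ring
  have hsq : CompIn O fun a => ‖(x a : 𝕜) + y a * RCLike.I‖ ^ 2 :=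
    ((hx.mul hx).add ((CompIn.rat (ComputableIn.const κ)).mul (hy.mul hy))).of_eq fun a =>
      (hκ _ _).symm
  refine (CompIn.rpow (half_pos hs) hhalf hsq fun a => sq_nonneg _).of_eq fun a => ?_
  rw [← Real.rpow_natCast, ← Real.rpow_mul (norm_nonneg _)]
  congr 1
  push_cast
  ring

end ScalarNorm

/-! ### Rational combinations and the perturbed unit vectors. -/

section Coefficients

/-- The coefficient of index `n` of a finite sequence of rational points, a code of `0` beyond
its length. -/
def coeff (l : List PointCode) (n : ℕ) : PointCode := l.getD n ((0, 0, 0), (0, 0, 0))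

theorem primrec_coeff : Primrec₂ coeff := list_getD _

variable (𝕜 : Type*) [RCLike 𝕜]

theorem PointCode.val_zero : PointCode.val 𝕜 ((0, 0, 0), (0, 0, 0)) = 0 := by
  simp [PointCode.val]

theorem val_coeff_of_le {l : List PointCode} {n : ℕ} (h : l.length ≤ n) :
    PointCode.val 𝕜 (coeff l n) = 0 := by
  rw [coeff, List.getD_eq_default _ _ h, PointCode.val_zero]

variable {V : Type*} [NormedAddCommGroup V] [NormedSpace 𝕜 V]

/-- Padding with zero coefficients allows a summation range larger than the list. -/
theorem ratComb_eq_sum_range (f : ℕ → V) (l : List PointCode) {N : ℕ} (hN : l.length ≤ N) :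
    ratComb 𝕜 f l = ∑ j ∈ Finset.range N, PointCode.val 𝕜 (coeff l j) • f j := by
  have h1 : ratComb 𝕜 f l =
      ∑ j ∈ Finset.range l.length, PointCode.val 𝕜 (coeff l j) • f j := by
    rw [← Fin.sum_univ_eq_sum_range (fun j => PointCode.val 𝕜 (coeff l j) • f j)]
    refine Finset.sum_congr rfl fun j _ => ?_
    simp [coeff, List.getD]
  rw [h1]
  refine Finset.sum_subset (Finset.range_mono hN) fun j _ hj => ?_
  rw [val_coeff_of_le 𝕜 (by simpa using hj), zero_smul]

theorem ratComb_nil (f : ℕ → V) : ratComb 𝕜 f [] = 0 := by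
  simp [ratComb]

end Coefficients

section Perturbed

variable {𝕜 : Type*} [RCLike 𝕜] {p : ℝ≥0∞}

/-- The standard unit vectors of `ℓ^p`, with the first one replaced by `w`. -/
noncomputable def perturbed (w : SeqSpace 𝕜 p) : ℕ → SeqSpace 𝕜 p
  | 0 => w
  | n + 1 => stdGen 𝕜 p (n + 1)

theorem stdGen_apply (n m : ℕ) : stdGen 𝕜 p n m = if m = n then 1 else 0 := by
  rw [stdGen, lp.single_apply, Pi.single_apply]

/-- The standard unit vectors are thus the trivial perturbation, with `d = 1` and `v = 0`, and the
results on `perturbed` apply to them. -/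
theorem perturbed_stdGen : perturbed (stdGen 𝕜 p 0) = stdGen 𝕜 p := by
  funext n
  cases n <;> rfl

theorem sum_smul_apply (s : Finset ℕ) (c : ℕ → 𝕜) (f : ℕ → SeqSpace 𝕜 p) (m : ℕ) :
    (∑ j ∈ s, c j • f j : SeqSpace 𝕜 p) m = ∑ j ∈ s, c j * f j m := by
  rw [lp.coeFn_sum, Finset.sum_apply]
  rfl

variable [Fact (1 ≤ p)]

theorem ratComb_perturbed_zero (w : SeqSpace 𝕜 p) (l : List PointCode) :
    ratComb 𝕜 (perturbed w) l 0 = PointCode.val 𝕜 (coeff l 0) * w 0 := by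
  rw [ratComb_eq_sum_range 𝕜 _ l (Nat.le_succ _), sum_smul_apply, Finset.sum_range_succ']
  simp [perturbed, stdGen_apply]

theorem ratComb_perturbed_succ (w : SeqSpace 𝕜 p) (l : List PointCode) (n : ℕ) :
    ratComb 𝕜 (perturbed w) l (n + 1) =
      PointCode.val 𝕜 (coeff l (n + 1)) + PointCode.val 𝕜 (coeff l 0) * w (n + 1) := by
  rw [ratComb_eq_sum_range 𝕜 _ l (N := (l.length + (n + 1)) + 1) (by omega), sum_smul_apply,
    Finset.sum_range_succ']
  congr 1
  simp only [perturbed, stdGen_apply]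
  rw [Finset.sum_eq_single n]
  · simp
  · intro j _ hj
    simp [Ne.symm hj]
  · intro h
    exact absurd (Finset.mem_range.2 (by omega)) h

theorem ratComb_stdGen_apply (l : List PointCode) (n : ℕ) :
    ratComb 𝕜 (stdGen 𝕜 p) l n = PointCode.val 𝕜 (coeff l n) := by
  rw [← perturbed_stdGen]
  cases n with
  | zero => rw [ratComb_perturbed_zero]; simp [stdGen_apply]
  | succ n => rw [ratComb_perturbed_succ]; simp [stdGen_apply]

/-- `w` is a vector of norm `1` with the nonnegative coordinates `d, v 0, v 1, …`. -/
structure IsUnitWith (w : SeqSpace 𝕜 p) (d : ℝ) (v : ℕ → ℝ) : Prop where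
  apply_zero : w 0 = (d : 𝕜)
  apply_succ : ∀ n, w (n + 1) = (v n : 𝕜)
  nonneg : 0 ≤ d
  nonneg_succ : ∀ n, 0 ≤ v n
  hasSum : HasSum (fun n => v n ^ p.toReal) (1 - d ^ p.toReal)

theorem toReal_pos (hp : p ≠ ∞) : 0 < p.toReal :=
  ENNReal.toReal_pos (zero_lt_one.trans_le (Fact.out : 1 ≤ p)).ne' hp

theorem one_le_toReal (hp : p ≠ ∞) : 1 ≤ p.toReal := by
  simpa using ENNReal.toReal_mono hp (Fact.out : 1 ≤ p)

theorem isUnitWith_stdGen (hp : p ≠ ∞) : IsUnitWith (stdGen 𝕜 p 0) 1 fun _ => 0 where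
  apply_zero := by simp [stdGen_apply]
  apply_succ n := by simp [stdGen_apply]
  nonneg := zero_le_one
  nonneg_succ _ := le_rfl
  hasSum := by simp [Real.zero_rpow (toReal_pos hp).ne']

variable {w : SeqSpace 𝕜 p} {d : ℝ} {v : ℕ → ℝ}

/-- From index `M + 1` on, the difference has the coordinates of `w` times minus the first
coefficient of `l₂`. Since `‖w‖ = 1`, the tail of `∑ v n ^ p` is one minus finitely many terms, so
the infinite sum becomes a finite expression. -/
theorem norm_rpow_sub (hp : p ≠ ∞) (hw : IsUnitWith w d v) (l₁ l₂ : List PointCode) {M : ℕ}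
    (h₁ : l₁.length ≤ M) (h₂ : l₂.length ≤ M) :
    ‖ratComb 𝕜 (stdGen 𝕜 p) l₁ - ratComb 𝕜 (perturbed w) l₂‖ ^ p.toReal =
      ‖PointCode.val 𝕜 (coeff l₁ 0) - PointCode.val 𝕜 (coeff l₂ 0) * d‖ ^ p.toReal +
      ∑ n ∈ Finset.range M, ‖PointCode.val 𝕜 (coeff l₁ (n + 1)) -
        PointCode.val 𝕜 (coeff l₂ (n + 1)) - PointCode.val 𝕜 (coeff l₂ 0) * v n‖ ^ p.toReal +
      ‖PointCode.val 𝕜 (coeff l₂ 0)‖ ^ p.toReal *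
        (1 - d ^ p.toReal - ∑ n ∈ Finset.range M, v n ^ p.toReal) := by
  set D : SeqSpace 𝕜 p := ratComb 𝕜 (stdGen 𝕜 p) l₁ - ratComb 𝕜 (perturbed w) l₂ with hD
  have hD0 : D 0 = PointCode.val 𝕜 (coeff l₁ 0) - PointCode.val 𝕜 (coeff l₂ 0) * d := by
    rw [hD, lp.coeFn_sub, Pi.sub_apply, ratComb_stdGen_apply, ratComb_perturbed_zero,
      hw.apply_zero]
  have hDs : ∀ n, D (n + 1) = PointCode.val 𝕜 (coeff l₁ (n + 1)) -
      PointCode.val 𝕜 (coeff l₂ (n + 1)) - PointCode.val 𝕜 (coeff l₂ 0) * v n := fun n => by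
    rw [hD, lp.coeFn_sub, Pi.sub_apply, ratComb_stdGen_apply, ratComb_perturbed_succ,
      hw.apply_succ, sub_sub]
  have hsum := (hasSum_nat_add_iff' (M + 1)).2 (lp.hasSum_norm (toReal_pos hp) D)
  have htail : HasSum (fun n => ‖D (n + (M + 1))‖ ^ p.toReal)
      (‖PointCode.val 𝕜 (coeff l₂ 0)‖ ^ p.toReal *
        (1 - d ^ p.toReal - ∑ n ∈ Finset.range M, v n ^ p.toReal)) := by
    refine (((hasSum_nat_add_iff' M).2 hw.hasSum).mul_left _).congr_fun ?_
    intro n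
    rw [← add_assoc, hDs, val_coeff_of_le 𝕜 (by omega), val_coeff_of_le 𝕜 (by omega),
      sub_zero, zero_sub, norm_neg, norm_mul, RCLike.norm_ofReal,
      abs_of_nonneg (hw.nonneg_succ _), Real.mul_rpow (norm_nonneg _) (hw.nonneg_succ _)]
  have := hsum.unique htail
  rw [Finset.sum_range_succ', hD0, Finset.sum_congr rfl fun n _ => by rw [hDs]] at this
  linarith

variable {O : Set (ℕ →. ℕ)}

/-- The sum of the contributions of the coordinates `1, …, M` to the norm of a difference. -/
theorem compIn_sum_norm_rpow (hp : p ≠ ∞) (hpc : CompIn O fun _ : Unit => p.toReal)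
    (hv : CompIn O v) :
    CompIn O fun q : List PointCode × List PointCode =>
      ∑ n ∈ Finset.range (q.1.length + q.2.length), ‖PointCode.val 𝕜 (coeff q.1 (n + 1)) -
        PointCode.val 𝕜 (coeff q.2 (n + 1)) - PointCode.val 𝕜 (coeff q.2 0) * v n‖ ^ p.toReal := by
  have hM : Primrec fun q : List PointCode × List PointCode => q.1.length + q.2.length :=
    nat_add_comp (list_length.comp fst) (list_length.comp snd)
  have ha : Primrec fun q : (List PointCode × List PointCode) × ℕ => coeff q.1.1 (q.2 + 1) :=
    primrec_coeff.comp (fst.comp fst) (succ.comp snd)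
  have hb : Primrec fun q : (List PointCode × List PointCode) × ℕ => coeff q.1.2 (q.2 + 1) :=
    primrec_coeff.comp (snd.comp fst) (succ.comp snd)
  have hc : Primrec fun q : (List PointCode × List PointCode) × ℕ => coeff q.1.2 0 :=
    primrec_coeff.comp (snd.comp fst) (Primrec.const 0)
  have hvn : CompIn O fun q : (List PointCode × List PointCode) × ℕ => v q.2 :=
    hv.comp ComputableIn.snd
  have hre := ((CompIn.rat (O := O) (fst.comp ha).computableIn).sub
    (CompIn.rat (fst.comp hb).computableIn)).sub ((CompIn.rat (fst.comp hc).computableIn).mul hvn)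
  have him := ((CompIn.rat (O := O) (snd.comp ha).computableIn).sub
    (CompIn.rat (snd.comp hb).computableIn)).sub ((CompIn.rat (snd.comp hc).computableIn).mul hvn)
  refine ((CompIn.norm_rpow 𝕜 (toReal_pos hp) hpc hre him).sum_range hM.computableIn).of_eq
    fun q => Finset.sum_congr rfl fun n _ => ?_
  simp only [PointCode.val]
  congr 2
  push_cast
  ring

/-- The distances between rational combinations of the standard unit vectors and of the perturbed
ones are computable from the first coordinate of the perturbation. -/
theorem compIn_norm_sub (hp : p ≠ ∞) (hpc : CompIn O fun _ : Unit => p.toReal) (hv : CompIn O v)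
    (hd : CompIn O fun _ : Unit => d) (hw : IsUnitWith w d v) :
    CompIn O fun q : List PointCode × List PointCode =>
      ‖ratComb 𝕜 (stdGen 𝕜 p) q.1 - ratComb 𝕜 (perturbed w) q.2‖ := by
  have hp0 := toReal_pos hp
  have hM : Primrec fun q : List PointCode × List PointCode => q.1.length + q.2.length :=
    nat_add_comp (list_length.comp fst) (list_length.comp snd)
  have ha : Primrec fun q : List PointCode × List PointCode => coeff q.1 0 :=
    primrec_coeff.comp fst (Primrec.const 0)
  have hb : Primrec fun q : List PointCode × List PointCode => coeff q.2 0 :=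
    primrec_coeff.comp snd (Primrec.const 0)
  have hd' : CompIn O fun _ : List PointCode × List PointCode => d :=
    hd.comp (ComputableIn.const ())
  have h0 : CompIn O fun q : List PointCode × List PointCode =>
      ‖PointCode.val 𝕜 (coeff q.1 0) - PointCode.val 𝕜 (coeff q.2 0) * d‖ ^ p.toReal :=
    (CompIn.norm_rpow 𝕜 hp0 hpc
      ((CompIn.rat (fst.comp ha).computableIn).sub
        ((CompIn.rat (fst.comp hb).computableIn).mul hd'))
      ((CompIn.rat (snd.comp ha).computableIn).sub
        ((CompIn.rat (snd.comp hb).computableIn).mul hd'))).of_eq fun q => by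
      simp only [PointCode.val]
      congr 2
      push_cast
      ring
  have hnb : CompIn O fun q : List PointCode × List PointCode =>
      ‖PointCode.val 𝕜 (coeff q.2 0)‖ ^ p.toReal :=
    CompIn.norm_rpow 𝕜 hp0 hpc (CompIn.rat (fst.comp hb).computableIn)
      (CompIn.rat (snd.comp hb).computableIn)
  have hvs : CompIn O fun q : List PointCode × List PointCode =>
      ∑ n ∈ Finset.range (q.1.length + q.2.length), v n ^ p.toReal :=
    CompIn.sum_range (x := fun q : (List PointCode × List PointCode) × ℕ => v q.2 ^ p.toReal)
      ((CompIn.rpow hp0 hpc hv hw.nonneg_succ).comp ComputableIn.snd) hM.computableIn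
  have h1 : CompIn O fun _ : List PointCode × List PointCode => (1 : ℝ) :=
    (CompIn.rat (ComputableIn.const ((1, 0, 0) : RatCode))).of_eq fun _ => RatCode.val_one
  refine CompIn.of_rpow hp0 hpc ?_ fun q => norm_nonneg _
  refine ((h0.add (compIn_sum_norm_rpow (𝕜 := 𝕜) hp hpc hv)).add
    (hnb.mul ((h1.sub (CompIn.rpow hp0 hpc hd' fun _ => hw.nonneg)).sub hvs))).of_eq fun q => ?_
  exact (norm_rpow_sub hp hw q.1 q.2 (Nat.le_add_right _ _) (Nat.le_add_left _ _)).symm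

/-- The norms of rational combinations of the perturbed unit vectors are computable from all but
the first coordinate of the perturbation. -/
theorem compIn_norm_perturbed (hp : p ≠ ∞) (hpc : CompIn O fun _ : Unit => p.toReal)
    (hv : CompIn O v) (hw : IsUnitWith w d v) :
    CompIn O fun l : List PointCode => ‖ratComb 𝕜 (perturbed w) l‖ := by
  have hp0 := toReal_pos hp
  have hb : Primrec fun l : List PointCode => coeff l 0 :=
    primrec_coeff.comp Primrec.id (Primrec.const 0)
  have hnb : CompIn O fun l : List PointCode => ‖PointCode.val 𝕜 (coeff l 0)‖ ^ p.toReal :=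
    CompIn.norm_rpow 𝕜 hp0 hpc (CompIn.rat (fst.comp hb).computableIn)
      (CompIn.rat (snd.comp hb).computableIn)
  have hvs : CompIn O fun l : List PointCode =>
      ∑ n ∈ Finset.range l.length, v n ^ p.toReal :=
    CompIn.sum_range (x := fun q : List PointCode × ℕ => v q.2 ^ p.toReal)
      ((CompIn.rpow hp0 hpc hv hw.nonneg_succ).comp ComputableIn.snd) list_length.computableIn
  have h1 : CompIn O fun _ : List PointCode => (1 : ℝ) :=
    (CompIn.rat (ComputableIn.const ((1, 0, 0) : RatCode))).of_eq fun _ => RatCode.val_one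
  have hS := (compIn_sum_norm_rpow (𝕜 := 𝕜) hp hpc hv).comp (g := fun l => ([], l))
    (pair (Primrec.const []) Primrec.id).computableIn
  refine CompIn.of_rpow hp0 hpc ?_ fun q => norm_nonneg _
  refine ((hnb.mul (h1.sub hvs)).add hS).of_eq fun l => ?_
  -- With a zero first combination, the coordinate of index `0` contributes `‖α‖ ^ p * d ^ p`, where
  -- `α` is the first coefficient of `l`. This cancels the `d ^ p` in the tail term, so `d` drops
  -- out.
  have := norm_rpow_sub hp hw [] l (M := l.length) (Nat.zero_le _) le_rfl
  rw [ratComb_nil, zero_sub, norm_neg, val_coeff_of_le 𝕜 (l := []) (Nat.zero_le _), zero_sub,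
    norm_neg, norm_mul, RCLike.norm_ofReal, abs_of_nonneg hw.nonneg,
    Real.mul_rpow (norm_nonneg _) hw.nonneg] at this
  rw [this]
  simp only [List.length_nil, zero_add]
  ring

end Perturbed

/-! ### Effective generating sets and computing the identity map. -/

section Generating

/-- The rationals within `2⁻¹ ^ k` of `x a` form an enumerable nonempty set, so a search finds one.
-/
theorem CompIn.exists_approx {α : Type*} [Primcodable α] {x : α → ℝ} (hx : CompIn ∅ x) :
    ∃ N : α × ℕ → RatCode, Computable N ∧ ∀ a k,
      (N (a, k)).val - (2 : ℝ)⁻¹ ^ k < x a ∧ x a < (N (a, k)).val + (2 : ℝ)⁻¹ ^ k := by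
  have hk : Primrec fun q : (α × ℕ) × RatCode => ((1, 0, 2 ^ q.1.2 - 1) : RatCode) :=
    RatCode.primrec_two_inv_pow.comp (snd.comp fst)
  have hx' : CompIn ∅ fun q : (α × ℕ) × RatCode => x q.1.1 :=
    hx.comp (fst.comp fst).computableIn
  have h1 := LowerIn.lt_right hx'.lower
    (RatCode.primrec_add.comp snd (RatCode.primrec_neg.comp hk)).computableIn
  have h2 := LowerIn.gt_right hx'.upper (RatCode.primrec_add.comp snd hk).computableIn
  obtain ⟨N, hN, h⟩ := REIn.exists_computableIn (R := fun (b : α × ℕ) (q : RatCode) =>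
    (RatCode.add q (RatCode.neg (1, 0, 2 ^ b.2 - 1))).val < x b.1 ∧
      x b.1 < (RatCode.add q (1, 0, 2 ^ b.2 - 1)).val) (h1.and h2) (fun b => by
    have hpos : (0 : ℝ) < (2 : ℝ)⁻¹ ^ b.2 := by positivity
    obtain ⟨q, hq, hq'⟩ := RatCode.exists_btwn (show x b.1 < x b.1 + (2 : ℝ)⁻¹ ^ b.2 by linarith)
    refine ⟨q, ?_, ?_⟩ <;>
      simp only [RatCode.val_add, RatCode.val_neg, RatCode.val_two_inv_pow] <;> linarith)
  refine ⟨N, Computable.of_computableIn_empty hN, fun a k => ?_⟩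
  simpa only [RatCode.val_add, RatCode.val_neg, RatCode.val_two_inv_pow, ← sub_eq_add_neg]
    using h (a, k)

variable {𝕜 : Type*} [RCLike 𝕜] {p : ℝ≥0∞}

theorem single_eq_smul_stdGen (n : ℕ) (c : 𝕜) :
    (lp.single p n c : SeqSpace 𝕜 p) = c • stdGen 𝕜 p n := by
  ext m
  rw [lp.coeFn_smul, Pi.smul_apply, stdGen_apply, lp.single_apply, Pi.single_apply]
  simp

variable [Fact (1 ≤ p)]

/-- Only the unit vector of index `0` is missing. Subtracting from `w` its remaining coordinates, a
limit of combinations of the other unit vectors, leaves `w 0` times it. -/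
theorem isGenerating_perturbed (hp : p ≠ ∞) {w : SeqSpace 𝕜 p} (hw : w 0 ≠ 0) :
    IsGenerating 𝕜 (perturbed w) := by
  set S := (Submodule.span 𝕜 (Set.range (perturbed w))).topologicalClosure with hS
  have hmem : ∀ n, perturbed w n ∈ S := fun n =>
    Submodule.le_topologicalClosure _ (Submodule.subset_span ⟨n, rfl⟩)
  have hclosed : IsClosed (S : Set (SeqSpace 𝕜 p)) := Submodule.isClosed_topologicalClosure _
  have hsucc : ∀ n, stdGen 𝕜 p (n + 1) ∈ S := fun n => hmem (n + 1)
  have hsum : ∀ x : SeqSpace 𝕜 p, HasSum (fun n => x n • stdGen 𝕜 p n) x := fun x => by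
    simpa only [single_eq_smul_stdGen] using lp.hasSum_single hp x
  have hzero : stdGen 𝕜 p 0 ∈ S := by
    have h1 := (hasSum_nat_add_iff' 1).2 (hsum w)
    have h2 : w - ∑ i ∈ Finset.range 1, w i • stdGen 𝕜 p i ∈ S :=
      hclosed.mem_of_tendsto h1 (Filter.Eventually.of_forall fun s =>
        S.sum_mem fun n _ => S.smul_mem _ (hsucc n))
    rw [Finset.sum_range_one] at h2
    have h3 : w 0 • stdGen 𝕜 p 0 ∈ S := by
      have := S.sub_mem (hmem 0) h2
      rwa [show perturbed w 0 = w from rfl, sub_sub_cancel] at this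
    exact (S.smul_mem_iff hw).1 h3
  have hall : ∀ n, stdGen 𝕜 p n ∈ S := fun n => by
    cases n with
    | zero => exact hzero
    | succ n => exact hsucc n
  refine Set.eq_univ_of_forall fun x => ?_
  exact hclosed.mem_of_tendsto (hsum x) (Filter.Eventually.of_forall fun s =>
    S.sum_mem fun n _ => S.smul_mem _ (hall n))

theorem isEffectiveGenerating_perturbed (hp : p ≠ ∞) (hpc : IsComputableReal p.toReal)
    {w : SeqSpace 𝕜 p} {d : ℝ} {v : ℕ → ℝ} (hv : CompIn ∅ v) (hd : d ≠ 0)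
    (hw : IsUnitWith w d v) : IsEffectiveGenerating 𝕜 (perturbed w) :=
  ⟨isGenerating_perturbed hp (by rw [hw.apply_zero]; exact_mod_cast hd),
    (compIn_norm_perturbed hp (IsComputableReal.compIn hpc) hv hw).exists_approx⟩

theorem PointCode.exists_val_dist_lt (z : 𝕜) {ε : ℝ} (hε : 0 < ε) :
    ∃ c : PointCode, ‖PointCode.val 𝕜 c - z‖ < ε := by
  obtain ⟨a, ha, ha'⟩ := RatCode.exists_btwn
    (show RCLike.re z < RCLike.re z + ε / 2 by linarith)
  obtain ⟨b, hb, hb'⟩ := RatCode.exists_btwn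
    (show RCLike.im z < RCLike.im z + ε / 2 by linarith)
  refine ⟨(a, b), ?_⟩
  have e : PointCode.val 𝕜 (a, b) - z = ((RatCode.val a - RCLike.re z : ℝ) : 𝕜) +
      ((RatCode.val b - RCLike.im z : ℝ) : 𝕜) * RCLike.I := by
    conv_lhs => rw [← RCLike.re_add_im z]
    simp only [PointCode.val]
    push_cast
    ring
  have hI : ‖(RCLike.I : 𝕜)‖ ≤ 1 := by
    by_cases h : (RCLike.I : 𝕜) = 0
    · simp [h]
    · exact (RCLike.norm_I_of_ne_zero h).le
  rw [e]
  calc _ ≤ ‖((RatCode.val a - RCLike.re z : ℝ) : 𝕜)‖ +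
        ‖((RatCode.val b - RCLike.im z : ℝ) : 𝕜) * RCLike.I‖ := norm_add_le _ _
    _ ≤ (RatCode.val a - RCLike.re z) + (RatCode.val b - RCLike.im z) := by
        rw [norm_mul, RCLike.norm_ofReal, RCLike.norm_ofReal, abs_of_nonneg (by linarith),
          abs_of_nonneg (by linarith)]
        have := mul_le_mul_of_nonneg_left hI (show 0 ≤ RatCode.val b - RCLike.im z by linarith)
        linarith
    _ < ε := by linarith

variable {V : Type*} [NormedAddCommGroup V] [NormedSpace 𝕜 V]

theorem IsGenerating.exists_ratComb_norm_sub_lt {f : ℕ → V} (hf : IsGenerating 𝕜 f) (x : V)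
    {ε : ℝ} (hε : 0 < ε) : ∃ l : List PointCode, ‖x - ratComb 𝕜 f l‖ < ε := by
  have hx : x ∈ closure (Submodule.span 𝕜 (Set.range f) : Set V) := by
    rw [IsGenerating] at hf
    rw [hf]
    trivial
  obtain ⟨y, hy, hxy⟩ := Metric.mem_closure_iff.1 hx (ε / 2) (half_pos hε)
  obtain ⟨c, rfl⟩ := (Finsupp.mem_span_range_iff_exists_finsupp).1 hy
  obtain ⟨N, hN⟩ : ∃ N, c.support ⊆ Finset.range N := c.support.exists_nat_subset_range
  -- Coefficient errors below `ε / 2 / B` move the combination by at most `ε / 2`; the summand `1`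
  -- keeps `B` positive.
  set B : ℝ := ∑ j ∈ Finset.range N, ‖f j‖ + 1 with hB
  have hB0 : 0 < B := by positivity
  choose a ha using fun n => PointCode.exists_val_dist_lt (c n) (div_pos (half_pos hε) hB0)
  refine ⟨(List.range N).map a, ?_⟩
  have hsum : (c.sum fun i r => r • f i) = ∑ j ∈ Finset.range N, c j • f j :=
    Finsupp.sum_of_support_subset _ hN _ fun _ _ => zero_smul _ _
  rw [hsum] at hxy
  have hl : ratComb 𝕜 f ((List.range N).map a) =
      ∑ j ∈ Finset.range N, PointCode.val 𝕜 (a j) • f j := by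
    rw [ratComb_eq_sum_range 𝕜 f _ (N := N) (by simp)]
    refine Finset.sum_congr rfl fun j hj => ?_
    rw [coeff]
    simp [List.getD, Finset.mem_range.1 hj]
  have h2 : ‖(∑ j ∈ Finset.range N, c j • f j) - ratComb 𝕜 f ((List.range N).map a)‖ ≤ ε / 2 := by
    rw [hl, ← Finset.sum_sub_distrib]
    calc _ ≤ ∑ j ∈ Finset.range N, ‖c j • f j - PointCode.val 𝕜 (a j) • f j‖ := norm_sum_le _ _
      _ ≤ ∑ j ∈ Finset.range N, ε / 2 / B * ‖f j‖ := Finset.sum_le_sum fun j _ => by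
          rw [← sub_smul, norm_smul, norm_sub_rev]
          exact mul_le_mul_of_nonneg_right (ha j).le (norm_nonneg _)
      _ = ε / 2 / B * (B - 1) := by rw [← Finset.mul_sum, hB]; ring
      _ ≤ ε / 2 / B * B := by
          refine mul_le_mul_of_nonneg_left (by linarith) (by positivity)
      _ = ε / 2 := div_mul_cancel₀ _ hB0.ne'
  rw [dist_eq_norm] at hxy
  calc ‖x - ratComb 𝕜 f ((List.range N).map a)‖
      = ‖(x - ∑ j ∈ Finset.range N, c j • f j) +
        ((∑ j ∈ Finset.range N, c j • f j) - ratComb 𝕜 f ((List.range N).map a))‖ := by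
        rw [sub_add_sub_cancel]
    _ ≤ _ := norm_add_le _ _
    _ < ε := by linarith

/-- A code of a positive rational number as a code of a rational number. -/
def PosRatCode.toRatCode (r : PosRatCode) : RatCode := (r.1 + 1, 0, r.2)

theorem PosRatCode.val_toRatCode (r : PosRatCode) : (toRatCode r).val = r.val := by
  simp [RatCode.val, PosRatCode.val, toRatCode]

theorem PosRatCode.primrec_toRatCode : Primrec PosRatCode.toRatCode :=
  pair (succ.comp fst) (pair (Primrec.const 0) snd)

theorem PosRatCode.val_pos (r : PosRatCode) : 0 < PosRatCode.val r := by
  rw [PosRatCode.val]; positivity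

theorem PosRatCode.exists_val_lt {ε : ℝ} (hε : 0 < ε) : ∃ r : PosRatCode, r.val < ε := by
  obtain ⟨n, hn⟩ := exists_nat_one_div_lt hε
  exact ⟨(0, n), by simpa [PosRatCode.val] using hn⟩

/-- If the distances between rational combinations of two generating sets are computable relative
to an oracle, then the oracle computes the identity with respect to these generating sets. -/
theorem oracleComputesMap_id {X : Set ℕ} {f g : ℕ → V} (hf : IsGenerating 𝕜 f)
    (hg : IsGenerating 𝕜 g)
    (h : CompIn {charFun X} fun q : List PointCode × List PointCode =>
      ‖ratComb 𝕜 f q.1 - ratComb 𝕜 g q.2‖) : OracleComputesMap 𝕜 X f g (fun v : V => v) := by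
  have hR : REIn {charFun X} fun q : BallCode × List PointCode =>
      ‖ratComb 𝕜 f q.1.1 - ratComb 𝕜 g q.2‖ < (PosRatCode.toRatCode q.1.2).val :=
    LowerIn.gt_right (x := fun q : BallCode × List PointCode =>
      ‖ratComb 𝕜 f q.1.1 - ratComb 𝕜 g q.2‖)
      (h.comp (g := fun q : BallCode × List PointCode => (q.1.1, q.2))
        (pair (fst.comp fst) snd).computableIn).upper
      (PosRatCode.primrec_toRatCode.comp (snd.comp fst)).computableIn
  obtain ⟨c, hc, hcb⟩ := REIn.exists_computableIn (R := fun (b : BallCode) (l : List PointCode) =>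
    ‖ratComb 𝕜 f b.1 - ratComb 𝕜 g l‖ < (PosRatCode.toRatCode b.2).val) hR fun b => by
      rw [PosRatCode.val_toRatCode]
      exact hg.exists_ratComb_norm_sub_lt _ (PosRatCode.val_pos _)
  simp only [PosRatCode.val_toRatCode] at hcb
  have hdouble : ∀ r : PosRatCode, PosRatCode.val (2 * r.1 + 1, r.2) = 2 * r.val := fun r => by
    simp only [PosRatCode.val]
    push_cast
    ring
  -- The new centre is closer than the radius to the old one, so doubling the radius covers the
  -- given ball.
  refine ⟨fun b => Part.some (c b, (2 * b.2.1 + 1, b.2.2)), ?_, ?_, ?_⟩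
  · exact ComputableIn.pair hc (pair (nat_double_succ.comp (fst.comp snd))
      (snd.comp snd)).computableIn
  · intro b b' hb' v hv
    obtain rfl := Part.mem_some_iff.1 hb'
    have hv' : dist v (ratComb 𝕜 f b.1) < PosRatCode.val b.2 := hv
    have := hcb b
    rw [← dist_eq_norm] at this
    show dist v (ratComb 𝕜 g (c b)) < PosRatCode.val (2 * b.2.1 + 1, b.2.2)
    rw [hdouble]
    linarith [dist_triangle v (ratComb 𝕜 f b.1) (ratComb 𝕜 g (c b))]
  · intro v U hU
    obtain ⟨ε, hε, H⟩ := Metric.mem_nhds_iff.1 hU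
    -- A point of the output ball is within `2r + r + r` of `v`.
    obtain ⟨r, hr⟩ := PosRatCode.exists_val_lt (show 0 < ε / 4 by linarith)
    obtain ⟨l, hl⟩ := hf.exists_ratComb_norm_sub_lt v (PosRatCode.val_pos r)
    refine ⟨(l, r), _, by rwa [← dist_eq_norm] at hl, Part.mem_some _, fun x hx => H ?_⟩
    have hx' : dist x (ratComb 𝕜 g (c (l, r))) < PosRatCode.val (2 * r.1 + 1, r.2) := hx
    rw [hdouble] at hx'
    have h2 := hcb (l, r)
    simp only at h2
    rw [← dist_eq_norm] at hl h2
    rw [Metric.mem_ball]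
    have t1 := dist_triangle x (ratComb 𝕜 g (c (l, r))) v
    have t2 := dist_triangle_left (ratComb 𝕜 g (c (l, r))) v (ratComb 𝕜 f l)
    rw [dist_comm v] at hl
    linarith

end Generating

/-! ### Surjective isometries of `ℓ^p` for `p ≠ 2`. -/

section Isometries

/-- Write `z ^ r = z * z ^ (r - 1)` and use that the second factor is strictly increasing. -/
theorem rpow_add_rpow_lt_add_rpow {u v r : ℝ} (hu : 0 < u) (hv : 0 < v) (hr : 1 < r) :
    u ^ r + v ^ r < (u + v) ^ r := by
  have key : ∀ {z : ℝ}, 0 < z → z ^ r = z * z ^ (r - 1) := fun hz => by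
    rw [Real.rpow_sub_one hz.ne']; field_simp
  have h1 : u ^ (r - 1) < (u + v) ^ (r - 1) :=
    Real.rpow_lt_rpow hu.le (by linarith) (by linarith)
  have h2 : v ^ (r - 1) < (u + v) ^ (r - 1) :=
    Real.rpow_lt_rpow hv.le (by linarith) (by linarith)
  rw [key hu, key hv, key (add_pos hu hv), add_mul]
  exact add_lt_add (mul_lt_mul_of_pos_left h1 hu) (mul_lt_mul_of_pos_left h2 hv)

theorem add_rpow_lt_rpow_add_rpow {u v r : ℝ} (hu : 0 < u) (hv : 0 < v) (hr : r < 1) :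
    (u + v) ^ r < u ^ r + v ^ r := by
  have key : ∀ {z : ℝ}, 0 < z → z ^ r = z * z ^ (r - 1) := fun hz => by
    rw [Real.rpow_sub_one hz.ne']; field_simp
  have h1 : (u + v) ^ (r - 1) < u ^ (r - 1) :=
    Real.rpow_lt_rpow_of_neg hu (by linarith) (by linarith)
  have h2 : (u + v) ^ (r - 1) < v ^ (r - 1) :=
    Real.rpow_lt_rpow_of_neg hv (by linarith) (by linarith)
  rw [key hu, key hv, key (add_pos hu hv), add_mul]
  exact add_lt_add (mul_lt_mul_of_pos_left h1 hu) (mul_lt_mul_of_pos_left h2 hv)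

variable {𝕜 : Type*} [RCLike 𝕜]

/-- The defect of the parallelogram identity with exponent `s`. -/
noncomputable def clarksonDefect (s : ℝ) (a b : 𝕜) : ℝ :=
  ‖a + b‖ ^ s + ‖a - b‖ ^ s - 2 * (‖a‖ ^ s + ‖b‖ ^ s)

theorem norm_rpow_eq_sq_rpow_half (s : ℝ) (a : 𝕜) : ‖a‖ ^ s = (‖a‖ ^ 2) ^ (s / 2) := by
  rw [← Real.rpow_natCast, ← Real.rpow_mul (norm_nonneg _)]
  congr 1
  push_cast
  ring

theorem half_norm_sq_add_norm_sq (a b : 𝕜) :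
    (1 / 2 : ℝ) * ‖a + b‖ ^ 2 + (1 / 2 : ℝ) * ‖a - b‖ ^ 2 = ‖a‖ ^ 2 + ‖b‖ ^ 2 := by
  have := parallelogram_law_with_norm 𝕜 a b
  linarith

theorem clarksonDefect_eq_zero {s : ℝ} (hs : 0 < s) {a b : 𝕜} (h : a = 0 ∨ b = 0) :
    clarksonDefect s a b = 0 := by
  rcases h with rfl | rfl <;> simp [clarksonDefect, Real.zero_rpow hs.ne'] <;> ring

/-- Convexity of `t ^ (s / 2)` at `‖a + b‖²` and `‖a - b‖²`, with the parallelogram law, bounds half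
the sum of the first two powers below by `(‖a‖² + ‖b‖²) ^ (s / 2)`. Strict superadditivity finishes.
For `s < 2` both inequalities are reversed. -/
theorem clarksonDefect_pos {s : ℝ} (hs : 2 < s) {a b : 𝕜} (ha : a ≠ 0) (hb : b ≠ 0) :
    0 < clarksonDefect s a b := by
  have h1 := (convexOn_rpow (show 1 ≤ s / 2 by linarith)).2 (sq_nonneg ‖a + b‖)
    (sq_nonneg ‖a - b‖) (show (0 : ℝ) ≤ 1 / 2 by norm_num) (show (0 : ℝ) ≤ 1 / 2 by norm_num)
    (by norm_num)
  simp only [smul_eq_mul] at h1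
  rw [half_norm_sq_add_norm_sq] at h1
  have h2 := rpow_add_rpow_lt_add_rpow (pow_pos (norm_pos_iff.2 ha) 2)
    (pow_pos (norm_pos_iff.2 hb) 2) (show 1 < s / 2 by linarith)
  simp only [clarksonDefect, norm_rpow_eq_sq_rpow_half s]
  linarith

theorem clarksonDefect_neg {s : ℝ} (hs0 : 0 < s) (hs : s < 2) {a b : 𝕜} (ha : a ≠ 0)
    (hb : b ≠ 0) : clarksonDefect s a b < 0 := by
  have h1 := (Real.concaveOn_rpow (show 0 ≤ s / 2 by linarith)
    (show s / 2 ≤ 1 by linarith)).2 (sq_nonneg ‖a + b‖)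
    (sq_nonneg ‖a - b‖) (show (0 : ℝ) ≤ 1 / 2 by norm_num) (show (0 : ℝ) ≤ 1 / 2 by norm_num)
    (by norm_num)
  simp only [smul_eq_mul] at h1
  rw [half_norm_sq_add_norm_sq] at h1
  have h2 := add_rpow_lt_rpow_add_rpow (pow_pos (norm_pos_iff.2 ha) 2)
    (pow_pos (norm_pos_iff.2 hb) 2) (show s / 2 < 1 by linarith)
  simp only [clarksonDefect, norm_rpow_eq_sq_rpow_half s]
  linarith

variable {p : ℝ≥0∞}

theorem toReal_ne_two (hp_fin : p ≠ ∞) (hp_two : p ≠ 2) : p.toReal ≠ 2 := fun h => by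
  apply hp_two
  rw [← ENNReal.ofReal_toReal hp_fin, h]
  simp

variable [Fact (1 ≤ p)]

/-- For `p ≠ 2`, two sequences have disjoint supports if and only if they satisfy the
parallelogram identity with exponent `p`. -/
theorem disjoint_support_iff (hp_fin : p ≠ ∞) (hp_two : p ≠ 2) (x y : SeqSpace 𝕜 p) :
    (∀ n, x n = 0 ∨ y n = 0) ↔ ‖x + y‖ ^ p.toReal + ‖x - y‖ ^ p.toReal =
      2 * (‖x‖ ^ p.toReal + ‖y‖ ^ p.toReal) := by
  have hs := toReal_pos hp_fin
  -- The defect of the norm identity is the sum of the coordinatewise defects. These all have the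
  -- same sign, so the sum vanishes only if each of them does.
  have hsum : HasSum (fun n => clarksonDefect p.toReal (x n) (y n))
      (‖x + y‖ ^ p.toReal + ‖x - y‖ ^ p.toReal - 2 * (‖x‖ ^ p.toReal + ‖y‖ ^ p.toReal)) :=
    ((lp.hasSum_norm hs (x + y)).add (lp.hasSum_norm hs (x - y))).sub
      (((lp.hasSum_norm hs x).add (lp.hasSum_norm hs y)).mul_left 2)
  constructor
  · intro h
    have h0 : HasSum (fun n => clarksonDefect p.toReal (x n) (y n)) 0 := by
      simp only [clarksonDefect_eq_zero hs (h _)]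
      exact hasSum_zero
    exact sub_eq_zero.1 (hsum.unique h0)
  · intro h n
    rw [h, sub_self] at hsum
    by_contra hn
    rw [not_or] at hn
    rcases (toReal_ne_two hp_fin hp_two).lt_or_gt with hlt | hgt
    · have hle : ∀ m, 0 ≤ -clarksonDefect p.toReal (x m) (y m) := fun m => by
        by_cases hm : x m = 0 ∨ y m = 0
        · rw [clarksonDefect_eq_zero hs hm, neg_zero]
        · rw [not_or] at hm
          exact (neg_pos.2 (clarksonDefect_neg hs hlt hm.1 hm.2)).le
      have h0 := hsum.neg
      rw [neg_zero, hasSum_zero_iff_of_nonneg hle] at h0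
      have := congrFun h0 n
      simp only [Pi.zero_apply] at this
      linarith [clarksonDefect_neg hs hlt hn.1 hn.2]
    · have hle : ∀ m, 0 ≤ clarksonDefect p.toReal (x m) (y m) := fun m => by
        by_cases hm : x m = 0 ∨ y m = 0
        · rw [clarksonDefect_eq_zero hs hm]
        · rw [not_or] at hm
          exact (clarksonDefect_pos hgt hm.1 hm.2).le
      rw [hasSum_zero_iff_of_nonneg hle] at hsum
      have := congrFun hsum n
      simp only [Pi.zero_apply] at this
      linarith [clarksonDefect_pos hgt hn.1 hn.2]

/-- Disjointness has been rewritten in terms of norms of sums and differences, which `T` preserves.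
-/
theorem disjoint_support_map_iff (hp_fin : p ≠ ∞) (hp_two : p ≠ 2)
    (T : SeqSpace 𝕜 p ≃ₗᵢ[𝕜] SeqSpace 𝕜 p) (x y : SeqSpace 𝕜 p) :
    (∀ n, T x n = 0 ∨ T y n = 0) ↔ ∀ n, x n = 0 ∨ y n = 0 := by
  rw [disjoint_support_iff hp_fin hp_two, disjoint_support_iff hp_fin hp_two, ← map_add,
    ← map_sub]
  simp only [LinearIsometryEquiv.norm_map]

theorem norm_stdGen (n : ℕ) : ‖stdGen 𝕜 p n‖ = 1 := by
  rw [stdGen, lp.norm_single (zero_lt_one.trans_le Fact.out)]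
  simp

/-- For `p ≠ 2`, a surjective linear isometry of `ℓ^p` maps some standard unit vector to a
unimodular multiple of the first one. -/
theorem exists_map_stdGen_eq (hp_fin : p ≠ ∞) (hp_two : p ≠ 2)
    (T : SeqSpace 𝕜 p ≃ₗᵢ[𝕜] SeqSpace 𝕜 p) :
    ∃ (j : ℕ) (c : 𝕜), ‖c‖ = 1 ∧ T (stdGen 𝕜 p j) = c • stdGen 𝕜 p 0 := by
  have hdisj := disjoint_support_map_iff hp_fin hp_two T
  set u := T.symm (stdGen 𝕜 p 0) with hu
  have hTu : T u = stdGen 𝕜 p 0 := T.apply_symm_apply _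
  have hu1 : ‖u‖ = 1 := by rw [hu, LinearIsometryEquiv.norm_map, norm_stdGen]
  obtain ⟨j, hj⟩ : ∃ j, u j ≠ 0 := by
    by_contra! h
    have : u = 0 := lp.ext (funext h)
    rw [this, norm_zero] at hu1
    exact zero_ne_one hu1
  -- Otherwise the image of the unit vector `j` is disjoint from `T u`, so that vector is disjoint
  -- from `u`, contrary to `u j ≠ 0`.
  have hTj : T (stdGen 𝕜 p j) 0 ≠ 0 := fun h0 => by
    have := (hdisj u (stdGen 𝕜 p j)).1 (fun n => by
      rw [hTu, stdGen_apply]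
      by_cases hn : n = 0
      · right; rw [hn, h0]
      · left; rw [if_neg hn]) j
    rw [stdGen_apply] at this
    simp [hj] at this
  -- The images of the unit vectors `i` and `j` are disjoint and the latter is nonzero at `0`. So
  -- the former vanishes there and is disjoint from `T u`.
  have hui : ∀ i, i ≠ j → u i = 0 := fun i hij => by
    have h1 := (hdisj (stdGen 𝕜 p i) (stdGen 𝕜 p j)).2 (fun n => by
      rw [stdGen_apply, stdGen_apply]
      by_cases hn : n = i
      · right; rw [if_neg (hn ▸ hij)]
      · left; rw [if_neg hn]) 0
    have h2 := (hdisj (stdGen 𝕜 p i) u).1 (fun n => by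
      rw [hTu, stdGen_apply]
      by_cases hn : n = 0
      · left; rw [hn]; exact h1.resolve_right hTj
      · right; rw [if_neg hn]) i
    rw [stdGen_apply] at h2
    simpa using h2
  have huj : u = u j • stdGen 𝕜 p j := by
    refine lp.ext (funext fun n => ?_)
    rw [lp.coeFn_smul, Pi.smul_apply, stdGen_apply]
    by_cases hn : n = j
    · simp [hn]
    · simp [hn, hui n hn]
  have hT : T (stdGen 𝕜 p j) = (u j)⁻¹ • stdGen 𝕜 p 0 := by
    rw [← hTu, eq_inv_smul_iff₀ hj, ← map_smul, ← huj]
  refine ⟨j, (u j)⁻¹, ?_, hT⟩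
  have := congrArg norm hT
  rwa [LinearIsometryEquiv.norm_map, norm_smul, norm_stdGen, norm_stdGen, mul_one, eq_comm] at this

end Isometries

/-! ### Weights encoding an enumeration of `C`. -/

section Enumeration

/-- `e` enumerates `C` without repetitions: the elements of `C` are the first components of the
pairs accepted by `e`, each of them occurring exactly once. -/
structure Enumerates (e : ℕ → Bool) (C : Set ℕ) : Prop where
  computable : ComputableIn ∅ e
  mem_iff : ∀ m, m ∈ C ↔ ∃ n, e n = true ∧ n.unpair.1 = m
  injective : ∀ n n', e n = true → e n' = true → n.unpair.1 = n'.unpair.1 → n = n'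

/-- A pair `(m, t)` is accepted only if `t` is the least witness for `m`, which prevents
repetitions. -/
theorem IsCE.exists_enumerates {C : Set ℕ} (hC : IsCE C) : ∃ e, Enumerates e C := by
  obtain ⟨f, hf, h⟩ := REIn.of_rePred (O := ∅) hC
  have hany : ComputableIn ∅ fun q : ℕ × ℕ => anyBelow (fun t => f (q.1, t)) q.2 :=
    ComputableIn.anyBelow (f := fun r : (ℕ × ℕ) × ℕ => f (r.1.1, r.2))
      (hf.comp (pair (fst.comp fst) snd).computableIn) ComputableIn.snd
  have hfirst : ComputableIn ∅ fun q : ℕ × ℕ => f q && !anyBelow (fun t => f (q.1, t)) q.2 :=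
    hf.and (ComputableIn.comp Primrec.not.computableIn hany)
  have hiff : ∀ m s, (f (m, s) && !anyBelow (fun t => f (m, t)) s) = true ↔
      f (m, s) = true ∧ ∀ t < s, f (m, t) ≠ true := fun m s => by
    rw [Bool.and_eq_true, Bool.not_eq_true', ← Bool.not_eq_true, anyBelow_iff]
    push Not
    rfl
  refine ⟨fun n => f n.unpair && !anyBelow (fun t => f (n.unpair.1, t)) n.unpair.2,
    hfirst.comp ComputableIn.unpair, fun m => (h m).trans ⟨fun hm => ?_, ?_⟩, ?_⟩
  · classical
    refine ⟨Nat.pair m (Nat.find hm), ?_, by simp⟩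
    rw [Nat.unpair_pair]
    exact (hiff _ _).2 ⟨Nat.find_spec hm, fun t ht => Nat.find_min hm ht⟩
  · rintro ⟨n, hn, rfl⟩
    exact ⟨_, ((hiff _ _).1 hn).1⟩
  · intro n n' hn hn' hm
    have h1 := (hiff _ _).1 hn
    have h2 := (hiff _ _).1 hn'
    have : n.unpair.2 = n'.unpair.2 := by
      rcases lt_trichotomy n.unpair.2 n'.unpair.2 with hlt | heq | hgt
      · exact absurd (hm ▸ h1.1) (h2.2 _ hlt)
      · exact heq
      · exact absurd (hm ▸ h2.1) (h1.2 _ hgt)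
    rw [← Nat.pair_unpair n, ← Nat.pair_unpair n', hm, this]

/-- The Boolean stating that `m` is enumerated by `e` before stage `M`. -/
def enteredBy (e : ℕ → Bool) (m M : ℕ) : Bool :=
  anyBelow (fun n => e n && decide (n.unpair.1 = m)) M

theorem enteredBy_iff {e : ℕ → Bool} {m M : ℕ} :
    enteredBy e m M = true ↔ ∃ n < M, e n = true ∧ n.unpair.1 = m := by
  simp [enteredBy, anyBelow_iff]

theorem computableIn_enteredBy {O : Set (ℕ →. ℕ)} {e : ℕ → Bool} (he : ComputableIn O e) :
    ComputableIn O fun q : ℕ × ℕ => enteredBy e q.1 q.2 :=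
  ComputableIn.anyBelow (f := fun r : (ℕ × ℕ) × ℕ => e r.2 && decide (r.2.unpair.1 = r.1.1))
    ((he.comp ComputableIn.snd).and (ComputableIn.decide
      (p := fun r : (ℕ × ℕ) × ℕ => r.2.unpair.1 = r.1.1)
      (Primrec.eq.comp (fst.comp (Primrec.unpair.comp snd)) (fst.comp fst))))
    ComputableIn.snd

/-- A code of the coordinate of index `n + 1` of the perturbation encoding the set enumerated
by `e`: it is `2⁻¹ ^ (m + 2)` if `m` is enumerated at stage `n`. -/
def weightCode (e : ℕ → Bool) (n : ℕ) : RatCode :=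
  bif e n then (1, 0, 2 ^ (n.unpair.1 + 2) - 1) else (0, 0, 0)

/-- The coordinate of index `n + 1` of the perturbation encoding the set enumerated by `e`. -/
noncomputable def weight (e : ℕ → Bool) (n : ℕ) : ℝ := (weightCode e n).val

variable {e : ℕ → Bool} {C : Set ℕ}

theorem weight_of_true {n : ℕ} (h : e n = true) : weight e n = (2 : ℝ)⁻¹ ^ (n.unpair.1 + 2) := by
  rw [weight, weightCode, h, cond_true, RatCode.val_two_inv_pow]

theorem weight_of_false {n : ℕ} (h : e n ≠ true) : weight e n = 0 := by
  rw [weight, weightCode, Bool.eq_false_of_not_eq_true h, cond_false, RatCode.val_zero]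

theorem weight_nonneg (e : ℕ → Bool) (n : ℕ) : 0 ≤ weight e n := by
  by_cases h : e n = true
  · rw [weight_of_true h]; positivity
  · rw [weight_of_false h]

theorem weight_le_one (e : ℕ → Bool) (n : ℕ) : weight e n ≤ 1 := by
  by_cases h : e n = true
  · rw [weight_of_true h]; exact pow_le_one₀ (by norm_num) (by norm_num)
  · rw [weight_of_false h]; exact zero_le_one

theorem compIn_weight {O : Set (ℕ →. ℕ)} (he : ComputableIn O e) : CompIn O (weight e) := by
  have h : ComputableIn O fun n : ℕ => ((1, 0, 2 ^ (n.unpair.1 + 2) - 1) : RatCode) :=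
    (RatCode.primrec_two_inv_pow.comp (nat_add_comp (fst.comp Primrec.unpair)
      (Primrec.const 2))).computableIn
  exact CompIn.rat (ComputableIn.comp (f := fun q : Bool × RatCode =>
    bif q.1 then q.2 else (0, 0, 0)) (Primrec.cond fst snd (Primrec.const _)).computableIn
    (he.pair h))

theorem sum_Ico_two_inv_pow_le (k K : ℕ) :
    ∑ m ∈ Finset.Ico k K, (2 : ℝ)⁻¹ ^ (m + 2) ≤ (2 : ℝ)⁻¹ ^ (k + 1) := by
  rw [Finset.sum_Ico_eq_sum_range]
  have : ∀ N : ℕ, ∑ i ∈ Finset.range N, (2 : ℝ)⁻¹ ^ (k + i + 2) =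
      (2 : ℝ)⁻¹ ^ (k + 1) - (2 : ℝ)⁻¹ ^ (k + N + 1) := fun N => by
    induction N with
    | zero => simp
    | succ N ih => rw [Finset.sum_range_succ, ih]; ring
  rw [this]
  have : (0 : ℝ) < (2 : ℝ)⁻¹ ^ (k + (K - k) + 1) := by positivity
  linarith

/-- Weights lie in `[0, 1]`, so the exponent `s ≥ 1` does not increase them. Distinct accepted
stages carry distinct elements, so the sum is dominated by a geometric series starting at `k`. -/
theorem sum_weight_rpow_le (he : Enumerates e C) {s : ℝ} (hs : 1 ≤ s) (k : ℕ) (t : Finset ℕ)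
    (h : ∀ n ∈ t, e n = true → k ≤ n.unpair.1) :
    ∑ n ∈ t, weight e n ^ s ≤ (2 : ℝ)⁻¹ ^ (k + 1) := by
  have hinj : Set.InjOn (fun n : ℕ => n.unpair.1) (t.filter fun n => e n = true) :=
    fun n hn n' hn' h => he.injective n n' (Finset.mem_filter.1 hn).2
      (Finset.mem_filter.1 hn').2 h
  obtain ⟨K, hK⟩ := ((t.filter fun n => e n = true).image
    fun n : ℕ => n.unpair.1).exists_nat_subset_range
  calc ∑ n ∈ t, weight e n ^ s ≤ ∑ n ∈ t, weight e n := Finset.sum_le_sum fun n _ => by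
        have := Real.rpow_le_rpow_of_exponent_ge' (weight_nonneg e n) (weight_le_one e n)
          zero_le_one hs
        rwa [Real.rpow_one] at this
    _ = ∑ n ∈ t.filter fun n => e n = true, weight e n :=
        (Finset.sum_filter_of_ne fun n _ hn => by_contra fun h => hn (weight_of_false h)).symm
    _ = ∑ n ∈ t.filter fun n => e n = true, (2 : ℝ)⁻¹ ^ (n.unpair.1 + 2) :=
        Finset.sum_congr rfl fun n hn => weight_of_true (Finset.mem_filter.1 hn).2
    _ = ∑ m ∈ (t.filter fun n => e n = true).image fun n : ℕ => n.unpair.1,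
          (2 : ℝ)⁻¹ ^ (m + 2) :=
        (Finset.sum_image (f := fun m => (2 : ℝ)⁻¹ ^ (m + 2)) hinj).symm
    _ ≤ ∑ m ∈ Finset.Ico k K, (2 : ℝ)⁻¹ ^ (m + 2) := by
        refine Finset.sum_le_sum_of_subset_of_nonneg (fun m hm => ?_)
          fun _ _ _ => by positivity
        have hmK := Finset.mem_range.1 (hK hm)
        obtain ⟨n, hn, rfl⟩ := Finset.mem_image.1 hm
        obtain ⟨hnt, hen⟩ := Finset.mem_filter.1 hn
        exact Finset.mem_Ico.2 ⟨h n hnt hen, hmK⟩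
    _ ≤ _ := sum_Ico_two_inv_pow_le k K

theorem weight_rpow_nonneg (e : ℕ → Bool) (s : ℝ) (n : ℕ) : 0 ≤ weight e n ^ s :=
  Real.rpow_nonneg (weight_nonneg e n) s

theorem summable_weight_rpow (he : Enumerates e C) {s : ℝ} (hs : 1 ≤ s) :
    Summable fun n => weight e n ^ s :=
  summable_of_sum_le (weight_rpow_nonneg e s)
    fun t => sum_weight_rpow_le he hs 0 t fun _ _ _ => Nat.zero_le _

/-- The sum of the powers with exponent `s` of the weights. -/
noncomputable def weightSum (e : ℕ → Bool) (s : ℝ) : ℝ := ∑' n, weight e n ^ s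

/-- This keeps the coordinate `d` of the perturbation positive. -/
theorem weightSum_le_half (he : Enumerates e C) {s : ℝ} (hs : 1 ≤ s) :
    weightSum e s ≤ 1 / 2 :=
  Real.tsum_le_of_sum_le (weight_rpow_nonneg e s) fun t =>
    (sum_weight_rpow_le he hs 0 t fun _ _ _ => Nat.zero_le _).trans (by norm_num)

theorem weightSum_nonneg (e : ℕ → Bool) (s : ℝ) : 0 ≤ weightSum e s :=
  tsum_nonneg (weight_rpow_nonneg e s)

theorem sum_range_add_le_weightSum (he : Enumerates e C) {s : ℝ} (hs : 1 ≤ s) {M n : ℕ}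
    (hn : M ≤ n) : ∑ i ∈ Finset.range M, weight e i ^ s + weight e n ^ s ≤ weightSum e s := by
  have := (summable_weight_rpow he hs).sum_le_tsum (insert n (Finset.range M))
    fun i _ => weight_rpow_nonneg e s i
  rwa [Finset.sum_insert (by simpa using hn), add_comm] at this

theorem sum_range_le_weightSum (he : Enumerates e C) {s : ℝ} (hs : 1 ≤ s) (M : ℕ) :
    ∑ i ∈ Finset.range M, weight e i ^ s ≤ weightSum e s :=
  (summable_weight_rpow he hs).sum_le_tsum _ fun i _ => weight_rpow_nonneg e s i

theorem exists_lt_sum_range (he : Enumerates e C) {s : ℝ} (hs : 1 ≤ s) {q : ℝ}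
    (hq : q < weightSum e s) : ∃ M, q < ∑ i ∈ Finset.range M, weight e i ^ s :=
  (((summable_weight_rpow he hs).hasSum.tendsto_sum_nat).eventually_const_lt hq).exists

/-- Once all elements of `C` below `k` have appeared, later stages can only enumerate elements that
are at least `k`. -/
theorem weightSum_le_of_entered (he : Enumerates e C) {s : ℝ} (hs : 1 ≤ s) {k M : ℕ}
    (h : ∀ m < k, m ∉ C ∨ enteredBy e m M = true) :
    weightSum e s ≤ ∑ i ∈ Finset.range M, weight e i ^ s + (2 : ℝ)⁻¹ ^ (k + 1) := by
  refine Real.tsum_le_of_sum_range_le (weight_rpow_nonneg e s) fun N => ?_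
  calc ∑ i ∈ Finset.range N, weight e i ^ s
      ≤ ∑ i ∈ Finset.range (M + N), weight e i ^ s :=
        Finset.sum_le_sum_of_subset_of_nonneg (Finset.range_mono (Nat.le_add_left _ _))
          fun _ _ _ => weight_rpow_nonneg e s _
    _ = ∑ i ∈ Finset.range M, weight e i ^ s + ∑ i ∈ Finset.Ico M (M + N), weight e i ^ s :=
        (Finset.sum_range_add_sum_Ico _ (Nat.le_add_right _ _)).symm
    _ ≤ _ := by
        refine add_le_add le_rfl (sum_weight_rpow_le he hs k _ fun n hn hen => ?_)
        by_contra! hlt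
        rcases h _ hlt with hC | hent
        · exact hC ((he.mem_iff _).2 ⟨n, hen, rfl⟩)
        · obtain ⟨n', hn', hen', heq⟩ := enteredBy_iff.1 hent
          rw [he.injective n' n hen' hen heq] at hn'
          exact absurd hn' (Finset.mem_Ico.1 hn).1.not_gt

theorem compIn_sum_range_weight {O : Set (ℕ →. ℕ)} (he : ComputableIn O e) {s : ℝ} (hs : 1 ≤ s)
    (hsc : CompIn O fun _ : Unit => s) :
    CompIn O fun M : ℕ => ∑ i ∈ Finset.range M, weight e i ^ s :=
  CompIn.sum_range (x := fun q : ℕ × ℕ => weight e q.2 ^ s)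
    ((CompIn.rpow (zero_lt_one.trans_le hs) hsc (compIn_weight he) (weight_nonneg e)).comp
      ComputableIn.snd) ComputableIn.id

theorem computableIn_charFun (X : Set ℕ) [DecidablePred (· ∈ X)] :
    ComputableIn {charFun X} fun n : ℕ => if n ∈ X then 1 else 0 :=
  (RecursiveIn.oracle _ (Set.mem_singleton _)).of_eq fun n => by
    simp only [charFun]
    congr

theorem compIn_weightSum (he : Enumerates e C) {s : ℝ} (hs : 1 ≤ s)
    (hsc : CompIn {charFun C} fun _ : Unit => s) :
    CompIn {charFun C} fun _ : Unit => weightSum e s := by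
  classical
  have hecomp : ComputableIn {charFun C} e := RecursiveIn.mono (Set.empty_subset _) he.computable
  have hsum := compIn_sum_range_weight hecomp hs hsc
  constructor
  · have h1 : REIn {charFun C} fun q : (Unit × RatCode) × ℕ =>
        q.1.2.val < ∑ i ∈ Finset.range q.2, weight e i ^ s :=
      LowerIn.lt_right (x := fun q : (Unit × RatCode) × ℕ =>
        ∑ i ∈ Finset.range q.2, weight e i ^ s)
        (hsum.comp ComputableIn.snd).lower (snd.comp fst).computableIn
    refine (REIn.ex (P := fun (q : Unit × RatCode) (M : ℕ) =>
      q.2.val < ∑ i ∈ Finset.range M, weight e i ^ s) h1).of_iff fun q => ?_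
    exact ⟨exists_lt_sum_range he hs, fun ⟨M, hM⟩ => hM.trans_le (sum_range_le_weightSum he hs M)⟩
  -- The oracle is needed only for upper bounds: it recognizes a stage after which no element below
  -- `k` can appear, so that the tail is at most `2⁻¹ ^ (k + 1)`.
  · have hnot : REIn {charFun C} fun m : ℕ => m ∉ C :=
      (REIn.comp (REIn.of_primrecPred (P := fun n : ℕ => n = 0)
        (Primrec.eq.comp Primrec.id (Primrec.const 0))) (computableIn_charFun C)).of_iff
        fun m => by by_cases hm : m ∈ C <;> simp [hm]
    have hent : REIn {charFun C} fun q : ℕ × ℕ => enteredBy e q.1 q.2 = true :=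
      REIn.of_computableIn (computableIn_enteredBy hecomp)
    have h1 : REIn {charFun C} fun q : (Unit × RatCode) × ℕ × ℕ =>
        ∀ m < q.2.1, m ∉ C ∨ enteredBy e m q.2.2 = true :=
      REIn.forall_lt (P := fun (q : (Unit × RatCode) × ℕ × ℕ) m =>
        m ∉ C ∨ enteredBy e m q.2.2 = true)
        ((hnot.comp ComputableIn.snd).or (hent.comp
          (g := fun r : ((Unit × RatCode) × ℕ × ℕ) × ℕ => (r.2, r.1.2.2))
          (pair snd (snd.comp (snd.comp fst))).computableIn)) (fst.comp snd).computableIn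
    have hpow : CompIn {charFun C} fun k : ℕ => (2 : ℝ)⁻¹ ^ (k + 1) :=
      (CompIn.rat (RatCode.primrec_two_inv_pow.comp succ).computableIn).of_eq fun k =>
        RatCode.val_two_inv_pow _
    have h2 : REIn {charFun C} fun q : (Unit × RatCode) × ℕ × ℕ =>
        ∑ i ∈ Finset.range q.2.2, weight e i ^ s + (2 : ℝ)⁻¹ ^ (q.2.1 + 1) < q.1.2.val :=
      LowerIn.gt_right (x := fun q : (Unit × RatCode) × ℕ × ℕ =>
        ∑ i ∈ Finset.range q.2.2, weight e i ^ s + (2 : ℝ)⁻¹ ^ (q.2.1 + 1))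
        ((hsum.comp (snd.comp snd).computableIn).add
          (hpow.comp (fst.comp snd).computableIn)).upper (snd.comp fst).computableIn
    refine LowerIn.upper_iff.2 ((REIn.ex (P := fun (q : Unit × RatCode) (r : ℕ × ℕ) =>
      (∀ m < r.1, m ∉ C ∨ enteredBy e m r.2 = true) ∧
        ∑ i ∈ Finset.range r.2, weight e i ^ s + (2 : ℝ)⁻¹ ^ (r.1 + 1) < q.2.val)
      (h1.and h2)).of_iff ?_)
    rintro ⟨-, q⟩
    simp only [Prod.exists]
    constructor
    · intro hq
      obtain ⟨k, hk⟩ := exists_pow_lt_of_lt_one (sub_pos.2 hq) (show (2 : ℝ)⁻¹ < 1 by norm_num)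
      have hstage : ∀ m, ∃ n, m ∈ C → e n = true ∧ n.unpair.1 = m := fun m => by
        by_cases hm : m ∈ C
        · obtain ⟨n, hn⟩ := (he.mem_iff m).1 hm
          exact ⟨n, fun _ => hn⟩
        · exact ⟨0, fun h => absurd h hm⟩
      choose n hn using hstage
      refine ⟨k, (Finset.range k).sup n + 1, fun m hm => ?_, ?_⟩
      · by_cases hmC : m ∈ C
        · exact Or.inr (enteredBy_iff.2 ⟨n m, Nat.lt_succ_of_le
            (Finset.le_sup (f := n) (Finset.mem_range.2 hm)), hn m hmC⟩)
        · exact Or.inl hmC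
      · have h1 := sum_range_le_weightSum he hs ((Finset.range k).sup n + 1)
        have h2 : (2 : ℝ)⁻¹ ^ (k + 1) ≤ (2 : ℝ)⁻¹ ^ k :=
          pow_le_pow_of_le_one (by norm_num) (by norm_num) (Nat.le_succ k)
        linarith
    · rintro ⟨k, M, h, hq⟩
      exact (weightSum_le_of_entered he hs h).trans_lt hq

/-- A set enumerated by `e` is computable relative to every oracle from which the sum of the
weights is upper semicomputable. -/
theorem computes_of_lowerIn_neg_weightSum {X : Set ℕ} (he : Enumerates e C) {s : ℝ} (hs : 1 ≤ s)
    (hsc : CompIn {charFun X} fun _ : Unit => s)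
    (h : LowerIn {charFun X} fun _ : Unit => -weightSum e s) : Computes X C := by
  classical
  have hecomp : ComputableIn {charFun X} e := RecursiveIn.mono (Set.empty_subset _) he.computable
  have hsum := compIn_sum_range_weight hecomp hs hsc
  have hpow : CompIn {charFun X} fun m : ℕ => ((2 : ℝ)⁻¹ ^ (m + 2)) ^ s :=
    CompIn.rpow (zero_lt_one.trans_le hs) hsc
      ((CompIn.rat (RatCode.primrec_two_inv_pow.comp (succ.comp succ)).computableIn).of_eq
        fun k => RatCode.val_two_inv_pow _) fun m => by positivity
  have hnent : REIn {charFun X} fun q : ℕ × ℕ => enteredBy e q.1 q.2 = false :=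
    (REIn.of_computableIn (ComputableIn.comp Primrec.not.computableIn
      (computableIn_enteredBy hecomp))).of_iff fun q => by simp
  have hlt : REIn {charFun X} fun q : ℕ × ℕ => weightSum e s <
      ∑ i ∈ Finset.range q.2, weight e i ^ s + ((2 : ℝ)⁻¹ ^ (q.1 + 2)) ^ s :=
    LowerIn.lt (x := fun _ : ℕ × ℕ => weightSum e s)
      (LowerIn.comp (x := fun _ : Unit => -weightSum e s) h (ComputableIn.const ()))
      ((hsum.comp ComputableIn.snd).add (hpow.comp ComputableIn.fst)).lower
  -- Absence of `m` is certified by a stage at which `m` has not appeared and the remaining tail is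
  -- smaller than the weight that `m` would still contribute.
  have hnotMem : REIn {charFun X} fun m : ℕ => m ∉ C := by
    refine (REIn.ex (P := fun (m M : ℕ) => enteredBy e m M = false ∧ weightSum e s <
      ∑ i ∈ Finset.range M, weight e i ^ s + ((2 : ℝ)⁻¹ ^ (m + 2)) ^ s)
      (hnent.and hlt)).of_iff fun m => ⟨fun hm => ?_, ?_⟩
    · have hpos : (0 : ℝ) < ((2 : ℝ)⁻¹ ^ (m + 2)) ^ s := by positivity
      obtain ⟨M, hM⟩ := exists_lt_sum_range he hs
        (show weightSum e s - ((2 : ℝ)⁻¹ ^ (m + 2)) ^ s < weightSum e s by linarith)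
      refine ⟨M, ?_, by linarith⟩
      rw [← Bool.not_eq_true, enteredBy_iff]
      rintro ⟨n, -, hn⟩
      exact hm ((he.mem_iff m).2 ⟨n, hn⟩)
    · rintro ⟨M, hM, hlt⟩ hm
      obtain ⟨n, hn, rfl⟩ := (he.mem_iff m).1 hm
      rw [← Bool.not_eq_true, enteredBy_iff] at hM
      have := sum_range_add_le_weightSum he hs (M := M) (n := n)
        (not_lt.1 fun hlt => hM ⟨n, hlt, hn, rfl⟩)
      rw [weight_of_true hn] at this
      linarith
  have hMem : REIn {charFun X} fun m : ℕ => m ∈ C := by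
    refine (REIn.ex (P := fun (m M : ℕ) => enteredBy e m M = true)
      (REIn.of_computableIn (computableIn_enteredBy hecomp))).of_iff fun m => ?_
    rw [he.mem_iff]
    simp only [enteredBy_iff]
    exact ⟨fun ⟨n, hn⟩ => ⟨n + 1, n, n.lt_succ_self, hn⟩, fun ⟨_, n, _, hn⟩ => ⟨n, hn⟩⟩
  have heq : ∀ k : ℕ, REIn {charFun X} fun q : ℕ × ℕ => q.2 = k := fun k =>
    REIn.of_primrecPred (Primrec.eq.comp snd (Primrec.const k))
  obtain ⟨g, hg, hgR⟩ := REIn.exists_computableIn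
    (R := fun m b : ℕ => (m ∈ C ∧ b = 1) ∨ (m ∉ C ∧ b = 0))
    (((hMem.comp ComputableIn.fst).and (heq 1)).or ((hnotMem.comp ComputableIn.fst).and (heq 0)))
    fun m => by by_cases hm : m ∈ C <;> simp [hm]
  refine RecursiveIn.of_eq hg fun m => ?_
  rcases hgR m with ⟨hm, hb⟩ | ⟨hm, hb⟩ <;> simp [charFun, hm, hb]

end Enumeration

/-! ### Recovering `d` from an isometry, and the theorem. -/

section Reduction

variable {𝕜 : Type*} [RCLike 𝕜] {p : ℝ≥0∞}

/-- The vector with the given coordinates of index `0` and of positive index. -/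
theorem exists_isUnitWith {d : ℝ} {v : ℕ → ℝ} (hd : 0 ≤ d) (hv : ∀ n, 0 ≤ v n)
    (h : HasSum (fun n => v n ^ p.toReal) (1 - d ^ p.toReal)) :
    ∃ w : SeqSpace 𝕜 p, IsUnitWith w d v := by
  let f : ℕ → 𝕜 := fun n => Nat.casesOn n (d : 𝕜) fun n => (v n : 𝕜)
  have hf : Memℓp f p := by
    refine memℓp_gen ((summable_nat_add_iff 1).1 (h.summable.congr fun n => ?_))
    show v n ^ p.toReal = ‖(v n : 𝕜)‖ ^ p.toReal
    rw [RCLike.norm_ofReal, abs_of_nonneg (hv n)]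
  exact ⟨⟨f, hf⟩, rfl, fun _ => rfl, hd, hv, h⟩

variable [Fact (1 ≤ p)]

/-- The smaller ball contains its centre and a point at distance `r / 2` from it, both within `ε` of
`y`. The convergence criterion controls balls only as sets; this turns it into a bound on radii. -/
theorem radius_lt_of_ball_subset {c y : SeqSpace 𝕜 p} {r ε : ℝ} (hr : 0 < r)
    (h : Metric.ball c r ⊆ Metric.ball y ε) : r < 4 * ε := by
  have h1 : dist c y < ε := h (Metric.mem_ball_self hr)
  have hz : dist (c + ((r / 2 : ℝ) : 𝕜) • stdGen 𝕜 p 0) c = r / 2 := by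
    rw [dist_eq_norm, add_sub_cancel_left, norm_smul, norm_stdGen, RCLike.norm_ofReal,
      abs_of_pos (half_pos hr), mul_one]
  have h2 : dist (c + ((r / 2 : ℝ) : 𝕜) • stdGen 𝕜 p 0) y < ε :=
    h (by rw [Metric.mem_ball, hz]; linarith)
  have := dist_triangle_right (c + ((r / 2 : ℝ) : 𝕜) • stdGen 𝕜 p 0) c y
  linarith

theorem exists_ratComb_eq_stdGen (j : ℕ) :
    ∃ l : List PointCode, ratComb 𝕜 (stdGen 𝕜 p) l = stdGen 𝕜 p j := by
  refine ⟨(List.range (j + 1)).map fun n =>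
    ((if n = j then (1, 0, 0) else (0, 0, 0), (0, 0, 0)) : PointCode), ?_⟩
  refine lp.ext (funext fun n => ?_)
  rw [ratComb_stdGen_apply, stdGen_apply, coeff]
  by_cases hn : n < j + 1
  · by_cases hnj : n = j <;> simp [List.getD, hn, hnj, PointCode.val]
  · have hnj : n ≠ j := by omega
    rw [List.getD_eq_default _ _ (by simpa using hn), PointCode.val_zero, if_neg hnj]

/-- Compare the coordinates of index `0`, where `w` alone among the perturbed vectors is seen.
Passing to absolute values eliminates the unknown `c`. -/
theorem norm_map_sub_apply_zero {w : SeqSpace 𝕜 p} {d : ℝ} {v : ℕ → ℝ}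
    (hw : IsUnitWith w d v) {c : 𝕜} (hc : ‖c‖ = 1) (l : List PointCode) :
    |1 - ‖PointCode.val 𝕜 (coeff l 0)‖ * d| ≤
      ‖c • stdGen 𝕜 p 0 - ratComb 𝕜 (perturbed w) l‖ := by
  have h := lp.norm_apply_le_norm (zero_lt_one.trans_le (Fact.out : 1 ≤ p)).ne'
    (c • stdGen 𝕜 p 0 - ratComb 𝕜 (perturbed w) l) 0
  refine le_trans ?_ h
  rw [lp.coeFn_sub, Pi.sub_apply, ratComb_perturbed_zero, hw.apply_zero, lp.coeFn_smul,
    Pi.smul_apply, stdGen_apply, if_pos rfl, smul_eq_mul, mul_one]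
  refine le_trans (le_of_eq ?_) (abs_norm_sub_norm_le _ _)
  rw [norm_mul, RCLike.norm_ofReal, abs_of_nonneg hw.nonneg, hc]

/-- An oracle that computes a surjective linear isometry of `ℓ^p`, `p ≠ 2`, with respect to the
standard and the perturbed unit vectors computes the first coordinate of the perturbation
from below. -/
theorem lowerIn_of_oracleComputesIsometry (hp_fin : p ≠ ∞) (hp_two : p ≠ 2)
    (hpc : IsComputableReal p.toReal) {w : SeqSpace 𝕜 p} {d : ℝ} {v : ℕ → ℝ}
    (hw : IsUnitWith w d v) (hd : 0 < d) (hd1 : d ≤ 1) {X : Set ℕ}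
    (hX : OracleComputesIsometry 𝕜 X (stdGen 𝕜 p) (perturbed w)) :
    LowerIn {charFun X} fun _ : Unit => d := by
  obtain ⟨T, P, hP, hsound, hconv⟩ := hX
  -- The index `j` is finite information built into the algorithm; it need not be found from `X`.
  obtain ⟨j, c, hc, hTj⟩ := exists_map_stdGen_eq hp_fin hp_two T
  obtain ⟨u, hu⟩ := exists_ratComb_eq_stdGen (𝕜 := 𝕜) (p := p) j
  have hgraph : REIn {charFun X} fun q : BallCode × BallCode => q.2 ∈ P q.1 :=
    REIn.graph (fun g hg => by
      classical
      obtain rfl := Set.mem_singleton_iff.1 hg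
      exact ⟨fun n => if n ∈ X then 1 else 0, rfl⟩) hP
  have hone : CompIn {charFun X} fun _ : Unit => (1 : ℝ) :=
    (CompIn.rat (ComputableIn.const ((1, 0, 0) : RatCode))).of_eq fun _ => RatCode.val_one
  have hzero : CompIn {charFun X} fun _ : ℕ => (0 : ℝ) :=
    (CompIn.rat (ComputableIn.const ((0, 0, 0) : RatCode))).of_eq fun _ => RatCode.val_zero
  have hdist : CompIn {charFun X} fun l : List PointCode =>
      ‖stdGen 𝕜 p j - ratComb 𝕜 (stdGen 𝕜 p) l‖ := by
    refine ((compIn_norm_sub hp_fin (IsComputableReal.compIn hpc) hzero hone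
      (isUnitWith_stdGen (𝕜 := 𝕜) hp_fin)).comp (g := fun l => (u, l))
      (pair (Primrec.const u) Primrec.id).computableIn).of_eq fun l => ?_
    rw [perturbed_stdGen, hu]
  have hball : REIn {charFun X} fun b : BallCode => stdGen 𝕜 p j ∈ ratBall 𝕜 (stdGen 𝕜 p) b :=
    (LowerIn.gt_right (x := fun b : BallCode => ‖stdGen 𝕜 p j - ratComb 𝕜 (stdGen 𝕜 p) b.1‖)
      (hdist.comp ComputableIn.fst).upper
      (PosRatCode.primrec_toRatCode.comp snd).computableIn).of_iff fun b => by
      rw [PosRatCode.val_toRatCode, ← dist_eq_norm]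
      rfl
  have hcoeff : Primrec fun q : (Unit × RatCode) × BallCode × BallCode => coeff q.2.2.1 0 :=
    primrec_coeff.comp (fst.comp (snd.comp snd)) (Primrec.const 0)
  have hnorm : CompIn {charFun X} fun q : (Unit × RatCode) × BallCode × BallCode =>
      ‖PointCode.val 𝕜 (coeff q.2.2.1 0)‖ :=
    (CompIn.norm_rpow 𝕜 zero_lt_one hone (CompIn.rat (fst.comp hcoeff).computableIn)
      (CompIn.rat (snd.comp hcoeff).computableIn)).of_eq fun q => Real.rpow_one _
  have hlt : REIn {charFun X} fun q : (Unit × RatCode) × BallCode × BallCode =>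
      q.1.2.val * ‖PointCode.val 𝕜 (coeff q.2.2.1 0)‖ < 1 - PosRatCode.val q.2.2.2 :=
    (((CompIn.rat (snd.comp fst).computableIn).mul hnorm).lt
      ((hone.comp (ComputableIn.const ())).sub (CompIn.rat (PosRatCode.primrec_toRatCode.comp
        (snd.comp (snd.comp snd))).computableIn))).of_iff fun q => by
      rw [PosRatCode.val_toRatCode]
  -- With `B` the absolute value of the first coefficient of the output centre and `r` the radius,
  -- `1 - r < B d`. Hence `q B < 1 - r` certifies `q < d`.
  refine (REIn.ex (P := fun (q : Unit × RatCode) (b : BallCode × BallCode) =>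
    (stdGen 𝕜 p j ∈ ratBall 𝕜 (stdGen 𝕜 p) b.1 ∧ b.2 ∈ P b.1) ∧
      q.2.val * ‖PointCode.val 𝕜 (coeff b.2.1 0)‖ < 1 - PosRatCode.val b.2.2)
    (((hball.comp (fst.comp snd).computableIn).and (hgraph.comp ComputableIn.snd)).and
      hlt)).of_iff ?_
  rintro ⟨-, q⟩
  have hclose : ∀ b b' : BallCode, stdGen 𝕜 p j ∈ ratBall 𝕜 (stdGen 𝕜 p) b → b' ∈ P b →
      |1 - ‖PointCode.val 𝕜 (coeff b'.1 0)‖ * d| < PosRatCode.val b'.2 := fun b b' hb hb' => by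
    have h := hsound b b' hb' _ hb
    rw [hTj] at h
    exact (norm_map_sub_apply_zero hw hc b'.1).trans_lt (by rwa [← dist_eq_norm])
  simp only
  constructor
  · intro hq
    -- The bound `r < 1 / 2` settles `q ≤ 0`. For `q > 0`, `B d < 1 + r` reduces the claim to `r (q
    -- + d) < d - q`, and `q + d ≤ 2`. The later division by `4` offsets the factor in
    -- `radius_lt_of_ball_subset`.
    have hη : 0 < min (1 / 2) ((d - q.val) / 2) := lt_min (by norm_num) (by linarith)
    obtain ⟨b, b', hb, hb', hsub⟩ := hconv (stdGen 𝕜 p j) (Metric.ball _ _)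
      (Metric.ball_mem_nhds _ (show 0 < min (1 / 2) ((d - q.val) / 2) / 4 by linarith))
    have hr := radius_lt_of_ball_subset (PosRatCode.val_pos b'.2) hsub
    have hr0 := PosRatCode.val_pos b'.2
    rw [mul_div_cancel₀ _ (by norm_num : (4 : ℝ) ≠ 0), lt_min_iff] at hr
    have hcl := abs_lt.1 (hclose b b' hb hb')
    refine ⟨(b, b'), ⟨hb, hb'⟩, ?_⟩
    simp only
    set B := ‖PointCode.val 𝕜 (coeff b'.1 0)‖
    have hB : 0 ≤ B := norm_nonneg _
    set r := PosRatCode.val b'.2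
    rcases le_or_gt q.val 0 with hq0 | hq0
    · have := mul_nonpos_of_nonpos_of_nonneg hq0 hB
      linarith
    · have h1 : d * (q.val * B) < d * (1 - r) := by
        have e1 : d * (q.val * B) = q.val * (B * d) := by ring
        have e2 : q.val * (B * d) ≤ q.val * (1 + r) :=
          mul_le_mul_of_nonneg_left (by linarith) hq0.le
        have e3 : r * (q.val + d) ≤ r * 2 := mul_le_mul_of_nonneg_left (by linarith) hr0.le
        rw [e1]
        nlinarith
      exact lt_of_mul_lt_mul_left h1 hd.le
  · rintro ⟨⟨b, b'⟩, ⟨hb, hb'⟩, hq⟩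
    have hcl := abs_lt.1 (hclose b b' hb hb')
    simp only at hq
    exact lt_of_mul_lt_mul_right (show q.val * ‖PointCode.val 𝕜 (coeff b'.1 0)‖ <
      d * ‖PointCode.val 𝕜 (coeff b'.1 0)‖ by linarith) (norm_nonneg _)

end Reduction

end EffBanach

theorem theorem2 (𝕜 : Type*) [RCLike 𝕜] (p : ℝ≥0∞) [Fact (1 ≤ p)] (hp_fin : p ≠ ∞)
    (hp_two : p ≠ 2) (hp_comp : EffBanach.IsComputableReal p.toReal)
    (C : Set ℕ) (hC : EffBanach.IsCE C) :
    ∃ F : ℕ → EffBanach.SeqSpace 𝕜 p,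
      EffBanach.IsEffectiveGenerating 𝕜 F ∧
      EffBanach.OracleComputesIsometry 𝕜 C (EffBanach.stdGen 𝕜 p) F ∧
      ∀ X : Set ℕ, EffBanach.OracleComputesIsometry 𝕜 X (EffBanach.stdGen 𝕜 p) F →
        EffBanach.Computes X C := by
  open EffBanach in
  obtain ⟨e, he⟩ := hC.exists_enumerates
  have hs := one_le_toReal hp_fin
  have hs0 := toReal_pos hp_fin
  have hγ := weightSum_le_half he hs
  have hγ0 := weightSum_nonneg e p.toReal
  have hδ : 0 < 1 - weightSum e p.toReal := by linarith
  -- This choice gives the perturbed vector norm `1`.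
  set d : ℝ := (1 - weightSum e p.toReal) ^ p.toReal⁻¹ with hd
  have hd0 : 0 < d := Real.rpow_pos_of_pos hδ _
  have hd1 : d ≤ 1 := Real.rpow_le_one hδ.le (by linarith) (inv_nonneg.2 hs0.le)
  have hdpow : d ^ p.toReal = 1 - weightSum e p.toReal := Real.rpow_inv_rpow hδ.le hs0.ne'
  obtain ⟨w, hw⟩ := exists_isUnitWith (𝕜 := 𝕜) (p := p) hd0.le (weight_nonneg e)
    (by rw [hdpow, sub_sub_cancel]; exact (summable_weight_rpow he hs).hasSum)
  have hone : ∀ O : Set (ℕ →. ℕ), CompIn O fun _ : Unit => (1 : ℝ) := fun O =>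
    (CompIn.rat (ComputableIn.const ((1, 0, 0) : RatCode))).of_eq fun _ => RatCode.val_one
  have hgen := isEffectiveGenerating_perturbed hp_fin hp_comp (compIn_weight he.computable)
    hd0.ne' hw
  refine ⟨perturbed w, hgen, ⟨LinearIsometryEquiv.refl 𝕜 _, ?_⟩, fun X hX => ?_⟩
  · have hdC : CompIn {charFun C} fun _ : Unit => d := by
      refine CompIn.of_rpow hs0 hp_comp.compIn ?_ fun _ => hd0.le
      exact ((hone _).sub (compIn_weightSum he hs hp_comp.compIn)).of_eq fun _ => hdpow.symm
    refine oracleComputesMap_id ?_ hgen.1 (compIn_norm_sub hp_fin hp_comp.compIn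
      (compIn_weight (RecursiveIn.mono (Set.empty_subset _) he.computable)) hdC hw)
    rw [← perturbed_stdGen]
    exact isGenerating_perturbed hp_fin (by simp [stdGen_apply])
  · have hlow := lowerIn_of_oracleComputesIsometry hp_fin hp_two hp_comp hw hd0 hd1 hX
    refine computes_of_lowerIn_neg_weightSum he hs hp_comp.compIn ?_
    -- Lower bounds of `d ^ p - 1` are lower bounds of the opposite of the sum of the weights.
    refine ((LowerIn.rpow hs0 hp_comp.compIn hlow fun _ => hd0.le).add
      (hone _).upper).of_eq fun _ => ?_
    rw [hdpow]
    ring
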